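/- All graphs are finite and simple. A class of graphs is hereditary if it is closed under isomorphism and deletion of vertices. A module of a graph $G$ is a set $M\subseteq V(G)$ such that every $x\in V(G)\setminus M$ is adjacent either to all elements of $M$ or to none of them; it is nontrivial if $|M|>1$ and $M\ne V(G)$. A graph is prime if it has no nontrivial module. For a class $\mathcal X$, let $[\mathcal X]_P$ be the class of all graphs whose every prime induced subgraph belongs to $\mathcal X$. For $w:V(G)\to\mathbb N$, the weighted chromatic number $\chi_w(G)$ is the smallest $k$ for which there is a function $c:V(G)\to 2^{\{1,\dots,k\}}$ with $|c(v)|=w(v)$ for every $v$ and $c(u)\cap c(v)=\emptyset$ for all adjacent $u,v$. A class $\mathcal X$ is easy for the weighted coloring problem if it is hereditary and there is an algorithm that, given $G\in\mathcal X$ and $w:V(G)\to\mathbb N$ (written in binary), computes $\chi_w(G)$ in time polynomial in the length of the input. It is easy for the coloring problem if it is hereditary and there is an algorithm that, given $G\in\mathcal X$ and a number $k$, decides whether $\chi(G)\le k$ in time polynomial in the length of the input. Theorem. If $\mathcal X$ is easy for the weighted coloring problem, then $[\mathcal X]_P$ is easy for the weighted coloring problem and, in particular, for the coloring problem. -/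

import Mathlib

namespace GraphColoring

/-! ### Graph classes -/

/-- A finite simple graph. Up to isomorphism its vertex set is `{0, …, n - 1}`. -/
abbrev FinGraph : Type := Σ n : ℕ, SimpleGraph (Fin n)

/-- `H` is isomorphic to an induced subgraph of `G`. -/
def IsInducedSubgraph (H G : FinGraph) : Prop := Nonempty (H.2 ↪g G.2)

/-- A class of graphs is hereditary if it is closed under isomorphism and deletion of vertices,
that is, under passing to (isomorphic copies of) induced subgraphs. -/
def Hereditary (X : Set FinGraph) : Prop :=
  ∀ G ∈ X, ∀ H, IsInducedSubgraph H G → H ∈ X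

/-! ### Modules and prime graphs -/

/-- `M` is a module of `G`: every vertex outside `M` is adjacent to all elements of `M` or to
none of them. -/
def IsModule {V : Type*} (G : SimpleGraph V) (M : Set V) : Prop :=
  ∀ x, x ∉ M → (∀ y ∈ M, G.Adj x y) ∨ (∀ y ∈ M, ¬ G.Adj x y)

/-- A nontrivial module has more than one element and is not the whole vertex set. -/
def IsNontrivialModule {V : Type*} (G : SimpleGraph V) (M : Set V) : Prop :=
  IsModule G M ∧ M.Nontrivial ∧ M ≠ Set.univ

/-- A graph is prime if it has no nontrivial modules. -/
def IsPrime {V : Type*} (G : SimpleGraph V) : Prop :=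
  ∀ M : Set V, ¬ IsNontrivialModule G M

/-- The class `[X]_P` of the graphs whose every prime induced subgraph belongs to `X`. -/
def primeClosure (X : Set FinGraph) : Set FinGraph :=
  {G | ∀ H, IsInducedSubgraph H G → IsPrime H.2 → H ∈ X}

/-! ### Weighted colorings -/

/-- `k` colors suffice to give each vertex `v` a set of exactly `w v` colors such that adjacent
vertices get disjoint sets. -/
def WeightedColorable {V : Type*} (G : SimpleGraph V) (w : V → ℕ) (k : ℕ) : Prop :=
  ∃ c : V → Finset (Fin k), (∀ v, (c v).card = w v) ∧ ∀ u v, G.Adj u v → Disjoint (c u) (c v)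

/-- The weighted chromatic number: the smallest `k` such that `k` colors suffice. -/
noncomputable def weightedChromaticNumber {V : Type*} (G : SimpleGraph V) (w : V → ℕ) : ℕ :=
  sInf {k | WeightedColorable G w k}

/-- On a finite graph some number of colors suffices, so the minimum is attained. -/
theorem weightedColorable_weightedChromaticNumber {V : Type*} [Fintype V]
    (G : SimpleGraph V) (w : V → ℕ) :
    WeightedColorable G w (weightedChromaticNumber G w) := by
  classical
  refine Nat.sInf_mem (s := {k | WeightedColorable G w k})
    ⟨Fintype.card (Σ v, Fin (w v)), ?_⟩
  let e := Fintype.equivFin (Σ v, Fin (w v))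
  refine ⟨fun v => Finset.univ.image fun i : Fin (w v) => e ⟨v, i⟩, fun v => ?_, ?_⟩
  · rw [Finset.card_image_of_injective _ fun i j h => by simpa using h]
    simp
  · intro u v huv
    rw [Finset.disjoint_left]
    rintro x hx hy
    simp only [Finset.mem_image, Finset.mem_univ, true_and] at hx hy
    obtain ⟨i, rfl⟩ := hx
    obtain ⟨j, hj⟩ := hy
    exact huv.ne (congrArg Sigma.fst (e.injective hj)).symm

/-! ### The two problems as problems about strings -/

/-- A natural number in binary, least significant digit first, as a string of bits. -/
def natCode (m : ℕ) : List Computability.Γ' :=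
  (Computability.encodeNat m).map Computability.Γ'.bit

open Classical in
/-- The row of the vertex `i` in the adjacency matrix, as a string of bits. -/
noncomputable def rowCode {n : ℕ} (G : SimpleGraph (Fin n)) (i : Fin n) : List Computability.Γ' :=
  (List.finRange n).map fun j => Computability.Γ'.bit (decide (G.Adj i j))

/-- Instances of the weighted coloring problem on the class `X`. -/
structure WeightedInstance (X : Set FinGraph) where
  graph : FinGraph
  graph_mem : graph ∈ X
  weight : Fin graph.1 → ℕ

/-- An instance of the weighted coloring problem as a string: for each vertex, its row of the
adjacency matrix and its weight in binary, each followed by a comma. -/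
noncomputable def WeightedInstance.encode {X : Set FinGraph} (I : WeightedInstance X) :
    List Computability.Γ' :=
  (List.finRange I.graph.1).flatMap fun i =>
    rowCode I.graph.2 i ++ Computability.Γ'.comma ::
      (natCode (I.weight i) ++ [Computability.Γ'.comma])

/-- Instances of the coloring problem on the class `X`: a graph in `X` and a number of colors. -/
structure ColoringInstance (X : Set FinGraph) where
  graph : FinGraph
  graph_mem : graph ∈ X
  colors : ℕ

/-- An instance of the coloring problem as a string: the rows of the adjacency matrix, each
followed by a comma, and then the number of colors in binary. -/
noncomputable def ColoringInstance.encode {X : Set FinGraph} (I : ColoringInstance X) :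
    List Computability.Γ' :=
  ((List.finRange I.graph.1).flatMap fun i =>
    rowCode I.graph.2 i ++ [Computability.Γ'.comma]) ++ natCode I.colors

/-- The answer to an instance of the weighted coloring problem. -/
noncomputable def WeightedInstance.answer {X : Set FinGraph} (I : WeightedInstance X) : ℕ :=
  weightedChromaticNumber I.graph.2 I.weight

open Classical in
/-- The answer to an instance of the coloring problem: is the chromatic number at most the given
number of colors? -/
noncomputable def ColoringInstance.answer {X : Set FinGraph} (I : ColoringInstance X) : Bool :=
  decide (I.graph.2.chromaticNumber ≤ (I.colors : ℕ∞))

/-! ### Easy classes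

A machine for a class `X` has to be correct and fast on the graphs of `X` only. -/

/-- `X` is hereditary, and some Turing machine, given `G ∈ X` and vertex weights `w` in binary,
outputs the weighted chromatic number in binary in time polynomial in the length of the input. -/
def EasyForWeightedColoring (X : Set FinGraph) : Prop :=
  Hereditary X ∧
    Nonempty (Turing.TM2ComputableInPolyTime (WeightedInstance.encode (X := X))
      Computability.encodeNat WeightedInstance.answer)

/-- `X` is hereditary, and some Turing machine, given `G ∈ X` and a number `k` in binary, decides
whether the chromatic number of `G` is at most `k` in time polynomial in the length of the
input. -/
def EasyForColoring (X : Set FinGraph) : Prop :=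
  Hereditary X ∧
    Nonempty (Turing.TM2ComputableInPolyTime (ColoringInstance.encode (X := X))
      Computability.encodeBool ColoringInstance.answer)

end GraphColoring

/-!
Why the theorem holds. In a graph `G` with at least two vertices take a module `M` that is minimal
among the modules with at least two elements. A module of `G[M]` is a module of `G`, so `G[M]` is
prime, and if `G` is in `[X]_P`, then `G[M]` is in `X` and the algorithm for `X` computes its
weighted chromatic number `k`. In a weighted coloring of `G` the module uses at least `k` colors,
and the vertices outside do not distinguish between its elements; hence replacing `M` by one of its
vertices, with the weight `k`, does not change the weighted chromatic number
(`weightedChromaticNumber_contract`). The smaller graph is an induced subgraph of `G`, so it is in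
`[X]_P` again. After at most `n` rounds one vertex is left, and the algorithm for `X` gives the
answer (`answer_primePart_iterate`). Minimal modules are found among the closures of the pairs of
vertices under adding vertices that distinguish between elements (`moduleMask_table`).

The numbers stay small: every weight is at most the weighted chromatic number, which is the same in
all rounds and at most the sum of the weights of the input (`size_iterate_le`).

The statement is about the Turing machines `TM2` of Mathlib, so a class of polynomial-time functions
has to be built. `Poly f` says that a machine computes `f` in polynomial time for given encodings
of the argument and the value by strings. Machines are assembled from fragments (`Frag`) with
time-bounded specifications (`Frag.Runs`), which can call given machines (`call_runs`). This shows
that `Poly` is closed under composition, pairing, and folding a function along a list when the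
intermediate values have polynomial length (`Poly.comp`, `Poly.pair`, `Poly.foldl`), and contains
the functions of finite-state transducers (`Poly.of_transduce`). The algorithm is then written with
list operations on adjacency tables, and transducers translate between tables and the encodings of
the two problems. Since the machine for `X` is only known to be correct on `X`, the intermediate
values are instances bundled with membership in their classes, and `Poly` is about functions on such
types.

For the coloring problem all weights are `1`, and the weighted chromatic number is compared with the
given number in binary (`leBits_eq`).
-/

open Turing

namespace PolyTime

/-! ### Program fragments for stack machines -/

/-- `b` is reached from `a` in at most `t` steps of the partial transition function `f`. -/
def ReachIn {C : Type*} (f : C → Option C) (a b : C) (t : ℕ) : Prop :=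
  ∃ m ≤ t, (flip bind f)^[m] (some a) = some b

namespace ReachIn
variable {C : Type*} {f : C → Option C} {a b c : C} {s t : ℕ}

theorem mono (h : ReachIn f a b s) (hst : s ≤ t) : ReachIn f a b t :=
  let ⟨m, hm, e⟩ := h
  ⟨m, hm.trans hst, e⟩

theorem trans (h₁ : ReachIn f a b s) (h₂ : ReachIn f b c t) : ReachIn f a c (s + t) := by
  obtain ⟨m, hm, e⟩ := h₁
  obtain ⟨n, hn, e'⟩ := h₂
  exact ⟨n + m, by omega, by rw [Function.iterate_add_apply, e, e']⟩

theorem single (h : f a = some b) : ReachIn f a b 1 := ⟨1, le_rfl, h⟩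

theorem head (h : f a = some b) (h₂ : ReachIn f b c t) : ReachIn f a c (t + 1) :=
  ((single h).trans h₂).mono (by omega)

end ReachIn

section Frag

variable {K : Type} {Γ : K → Type} {σ : Type}

/-- A program fragment for a `TM2` machine: finitely many labels, one of which is the entry, and
code that is parametric in the surrounding machine. `code inj exit l` is the statement at the
label `l` when the labels of the fragment are placed into the labels `Λ` of the machine by `inj`
and the fragment is left by jumping to `exit`. Such fragments can be put in sequence without
renaming labels in a machine that is already built. -/
structure Frag (Γ : K → Type) (σ : Type) : Type 1 where
  L : Type
  fin : Fintype L
  entry : L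
  code : ∀ {Λ : Type}, (L → Λ) → Λ → L → TM2.Stmt Γ Λ σ

namespace Frag

section
variable [DecidableEq K]

/-- In every machine that contains the fragment `c`, a run that enters `c` with the internal state
`v` and the stacks `S` leaves it with `v'` and `S'` after at most `t` steps. -/
def Runs (c : Frag Γ σ) (v : σ) (S : ∀ k, List (Γ k)) (v' : σ) (S' : ∀ k, List (Γ k)) (t : ℕ) :
    Prop :=
  ∀ (Λ : Type) (M : Λ → TM2.Stmt Γ Λ σ) (inj : c.L → Λ) (exit : Λ),
    (∀ l, M (inj l) = c.code inj exit l) →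
    ReachIn (TM2.step M) ⟨some (inj c.entry), v, S⟩ ⟨some exit, v', S'⟩ t

variable {c d : Frag Γ σ} {v v₁ v' : σ} {S S₁ S' : ∀ k, List (Γ k)} {s t : ℕ}

theorem Runs.mono (h : c.Runs v S v' S' s) (hst : s ≤ t) : c.Runs v S v' S' t :=
  fun Λ M inj exit hM => (h Λ M inj exit hM).mono hst

end

/-- Run `c`, then `d`. -/
def seq (c d : Frag Γ σ) : Frag Γ σ where
  L := c.L ⊕ d.L
  fin := letI := c.fin; letI := d.fin; inferInstance
  entry := .inl c.entry
  code inj exit := Sum.elim (c.code (fun l => inj (.inl l)) (inj (.inr d.entry)))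
    (d.code (fun l => inj (.inr l)) exit)

/-- A fragment with a single label. The statement `q self exit` may jump back or leave. -/
def rep (q : ∀ {Λ : Type}, Λ → Λ → TM2.Stmt Γ Λ σ) : Frag Γ σ where
  L := Unit
  fin := inferInstance
  entry := ()
  code inj exit _ := q (inj ()) exit

/-- Repeat `c` while the test `b` holds after peeking at the stack `k`. -/
def whilePeek (k : K) (f : σ → Option (Γ k) → σ) (b : σ → Bool) (c : Frag Γ σ) : Frag Γ σ where
  L := Option c.L
  fin := letI := c.fin; inferInstance
  entry := none
  code inj exit l := l.elim
    (.peek k f (.branch b (.goto fun _ => inj (some c.entry)) (.goto fun _ => exit)))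
    (c.code (fun l => inj (some l)) (inj none))

section
variable [DecidableEq K]
variable {c d : Frag Γ σ} {v v₁ v' : σ} {S S₁ S' : ∀ k, List (Γ k)} {s t : ℕ}

theorem Runs.seq (h₁ : c.Runs v S v₁ S₁ s) (h₂ : d.Runs v₁ S₁ v' S' t) :
    (c.seq d).Runs v S v' S' (s + t) :=
  fun Λ M inj exit hM =>
    (h₁ Λ M (fun l => inj (.inl l)) (inj (.inr d.entry)) fun l => hM (.inl l)).trans
      (h₂ Λ M (fun l => inj (.inr l)) exit fun l => hM (.inr l))

theorem rep_exit {q : ∀ {Λ : Type}, Λ → Λ → TM2.Stmt Γ Λ σ}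
    (h : ∀ {Λ : Type} (self exit : Λ), TM2.stepAux (q self exit) v S = ⟨some exit, v', S'⟩) :
    (rep q).Runs v S v' S' 1 := by
  intro Λ M inj exit hM
  exact ReachIn.single (by rw [TM2.step, hM]; exact congrArg some (h _ _))

theorem rep_next {q : ∀ {Λ : Type}, Λ → Λ → TM2.Stmt Γ Λ σ}
    (h : ∀ {Λ : Type} (self exit : Λ), TM2.stepAux (q self exit) v S = ⟨some self, v₁, S₁⟩)
    (h' : (rep q).Runs v₁ S₁ v' S' t) :
    (rep q).Runs v S v' S' (t + 1) := by
  intro Λ M inj exit hM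
  exact (h' Λ M inj exit hM).head (by rw [TM2.step, hM]; exact congrArg some (h _ _))

theorem whilePeek_exit {k : K} {f : σ → Option (Γ k) → σ} {b : σ → Bool}
    (h : b (f v (S k).head?) = false) :
    (whilePeek k f b c).Runs v S (f v (S k).head?) S 1 := by
  intro Λ M inj exit hM
  refine ReachIn.single ?_
  rw [TM2.step, hM]
  simp [whilePeek, h]

theorem whilePeek_next {k : K} {f : σ → Option (Γ k) → σ} {b : σ → Bool}
    (h : b (f v (S k).head?) = true) (h₁ : c.Runs (f v (S k).head?) S v₁ S₁ s)
    (h₂ : (whilePeek k f b c).Runs v₁ S₁ v' S' t) :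
    (whilePeek k f b c).Runs v S v' S' (s + t + 1) := by
  intro Λ M inj exit hM
  refine ReachIn.head (b := ⟨some (inj (some c.entry)), f v (S k).head?, S⟩) ?_
    ((h₁ Λ M (fun l => inj (some l)) (inj none) fun l => hM (some l)).trans (h₂ Λ M inj exit hM))
  rw [TM2.step, hM]
  simp [whilePeek, h]

end

section Move
variable {A τ : Type} {Γ : K → Type} [Inhabited A]

/-- Empty the stack `k` onto the stack `k'`, translating its symbols by `h` and then `g`. The
symbol under way is kept in the first component of the internal state. -/
def move (k k' : K) (h : Γ k → A) (g : A → Γ k') : Frag Γ (Option A × τ) :=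
  rep fun self exit =>
    .pop k (fun v o => (o.map h, v.2)) <|
      .branch (fun v => v.1.isSome) (.push k' (fun v => g (v.1.getD default)) (.goto fun _ => self))
        (.goto fun _ => exit)

/-- Like `move`, with two copies made. -/
def move₂ (k k' k'' : K) (h : Γ k → A) (g : A → Γ k') (g' : A → Γ k'') : Frag Γ (Option A × τ) :=
  rep fun self exit =>
    .pop k (fun v o => (o.map h, v.2)) <|
      .branch (fun v => v.1.isSome) (.push k' (fun v => g (v.1.getD default))
        (.push k'' (fun v => g' (v.1.getD default)) (.goto fun _ => self)))
        (.goto fun _ => exit)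

variable [DecidableEq K]

theorem move_runs {k k' : K} (hk : k ≠ k') {h : Γ k → A} {g : A → Γ k'} {x : List (Γ k)}
    {o : Option A} {w : τ} {S S' : ∀ k, List (Γ k)} (hx : S k = x)
    (hS' : S' = Function.update (Function.update S k []) k'
      ((x.map fun a => g (h a)).reverse ++ S k')) :
    (move k k' h g).Runs (o, w) S (none, w) S' (x.length + 1) := by
  induction x generalizing S o with
  | nil =>
    subst hS'
    refine rep_exit fun self exit => ?_
    simp [hx, hk.symm]
  | cons a x ih =>
    refine rep_next (v₁ := (some (h a), w))
      (S₁ := Function.update (Function.update S k x) k' (g (h a) :: S k')) (fun self exit => ?_)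
      (ih ?_ ?_)
    · simp [hx, hk.symm]
    · simp [hk]
    · subst hS'
      funext j
      by_cases h2 : j = k'
      · subst h2; simp
      by_cases h3 : j = k
      · subst h3; simp [hk]
      simp [h2, h3]

theorem move₂_runs {k k' k'' : K} (hk : k ≠ k') (hk' : k ≠ k'') (hkk : k' ≠ k'') {h : Γ k → A}
    {g : A → Γ k'} {g' : A → Γ k''} {x : List (Γ k)}
    {o : Option A} {w : τ} {S S' : ∀ k, List (Γ k)} (hx : S k = x)
    (hS' : S' = Function.update (Function.update (Function.update S k []) k'
      ((x.map fun a => g (h a)).reverse ++ S k')) k''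
        ((x.map fun a => g' (h a)).reverse ++ S k'')) :
    (move₂ k k' k'' h g g').Runs (o, w) S (none, w) S' (x.length + 1) := by
  induction x generalizing S o with
  | nil =>
    subst hS'
    refine rep_exit fun self exit => ?_
    have : S = Function.update S k [] := by rw [← hx, Function.update_eq_self]
    rw [← this]
    simp [hx, ← this]
  | cons a x ih =>
    refine rep_next (v₁ := (some (h a), w))
      (S₁ := Function.update (Function.update (Function.update S k x) k' (g (h a) :: S k')) k''
        (g' (h a) :: S k''))
      (fun self exit => ?_) (ih ?_ ?_)
    · simp [hx, hk.symm, hk'.symm, hkk.symm]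
    · simp [hk, hk']
    · subst hS'
      funext j
      by_cases h1 : j = k''
      · subst h1; simp
      by_cases h2 : j = k'
      · subst h2; simp [hkk]
      by_cases h3 : j = k
      · subst h3; simp [hk, hk']
      simp [h1, h2, h3]

end Move

/-- The machine that consists of one fragment. -/
abbrev toFinTM2 [DecidableEq K] [Fintype K] [Fintype σ] (k₀ k₁ : K) [Fintype (Γ k₀)] (v : σ)
    (c : Frag Γ σ) : FinTM2 where
  k₀ := k₀
  k₁ := k₁
  Γ := Γ
  Λ := Option c.L
  main := some c.entry
  ΛFin := letI := c.fin; inferInstance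
  σ := σ
  initialState := v
  m l := l.elim .halt (c.code some none)

end Frag
end Frag

/-- The stacks of a machine at the start, when the stack `k` contains `x` and others are empty. -/
theorem initList_eq (tm : FinTM2) (x : List (tm.Γ tm.k₀)) :
    initList tm x = ⟨some tm.main, tm.initialState, Function.update (fun _ => []) tm.k₀ x⟩ := by
  unfold initList
  congr 1
  funext k
  by_cases h : k = tm.k₀
  · subst h; simp
  · simp [h]

theorem haltList_eq (tm : FinTM2) (x : List (tm.Γ tm.k₁)) :
    haltList tm x = ⟨none, tm.initialState, Function.update (fun _ => []) tm.k₁ x⟩ := by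
  unfold haltList
  congr 1
  funext k
  by_cases h : k = tm.k₁
  · subst h; simp
  · simp [h]

/-- The machine `tm` turns the input `x` into the output `y` in at most `t` steps. -/
def Outputs (tm : FinTM2) (x : List (tm.Γ tm.k₀)) (y : List (tm.Γ tm.k₁)) (t : ℕ) : Prop :=
  Nonempty (TM2OutputsInTime tm x (some y) t)

theorem outputs_iff {tm : FinTM2} {x : List (tm.Γ tm.k₀)} {y : List (tm.Γ tm.k₁)} {t : ℕ} :
    Outputs tm x y t ↔ ReachIn (TM2.step tm.m)
      ⟨some tm.main, tm.initialState, Function.update (fun _ => []) tm.k₀ x⟩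
      ⟨none, tm.initialState, Function.update (fun _ => []) tm.k₁ y⟩ t := by
  constructor
  · rintro ⟨⟨⟨m, e⟩, hm⟩⟩
    refine ⟨m, hm, ?_⟩
    rw [initList_eq, Option.map_some, haltList_eq] at e
    exact e
  · rintro ⟨m, hm, e⟩
    refine ⟨⟨⟨m, ?_⟩, hm⟩⟩
    rw [initList_eq, Option.map_some, haltList_eq]
    exact e

theorem Frag.Runs.outputs {K : Type} {Γ : K → Type} {σ : Type} [DecidableEq K] [Fintype K]
    [Fintype σ] {k₀ k₁ : K} [Fintype (Γ k₀)] {v : σ} {c : Frag Γ σ} {x : List (Γ k₀)}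
    {y : List (Γ k₁)} {t : ℕ}
    (h : c.Runs v (Function.update (fun _ => []) k₀ x) v (Function.update (fun _ => []) k₁ y) t) :
    Outputs (c.toFinTM2 k₀ k₁ v) x y (t + 1) := by
  exact outputs_iff.2 <|
    (h _ (c.toFinTM2 k₀ k₁ v).m some none fun l => rfl).trans (ReachIn.single rfl)

/-! ### Output lengths -/

section Growth

variable {K : Type} [DecidableEq K] {Γ : K → Type} {Λ σ : Type}

/-- An upper bound for the number of symbols that a statement pushes. -/
def pushCount : TM2.Stmt Γ Λ σ → ℕ
  | .push _ _ q => pushCount q + 1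
  | .peek _ _ q => pushCount q
  | .pop _ _ q => pushCount q
  | .load _ q => pushCount q
  | .branch _ q₁ q₂ => pushCount q₁ + pushCount q₂
  | .goto _ => 0
  | .halt => 0

theorem length_stepAux_le (q : TM2.Stmt Γ Λ σ) (v : σ) (S : ∀ k, List (Γ k)) (k : K) :
    ((TM2.stepAux q v S).stk k).length ≤ (S k).length + pushCount q := by
  induction q generalizing v S with
  | push k' f q ih =>
    refine (ih _ _).trans ?_
    by_cases h : k = k'
    · subst h; simp only [Function.update_self, List.length_cons, pushCount]; omega
    · simp [h, pushCount]
  | peek k' f q ih => exact ih _ _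
  | pop k' f q ih =>
    refine (ih _ _).trans ?_
    by_cases h : k = k'
    · subst h; simp [pushCount]
    · simp [h, pushCount]
  | load f q ih => exact ih _ _
  | branch b q₁ q₂ ih₁ ih₂ =>
    simp only [TM2.stepAux, pushCount]
    cases b v
    · exact (ih₂ _ _).trans (by omega)
    · exact (ih₁ _ _).trans (by omega)
  | goto f => simp [pushCount]
  | halt => simp [pushCount]

/-- A machine pushes boundedly many symbols in a step, so its output is not much longer than its
input and its running time. -/
theorem exists_length_output_le (tm : FinTM2) : ∃ c, ∀ x y t, Outputs tm x y t →
    y.length ≤ x.length + t * c := by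
  classical
  let _ := tm.ΛFin
  refine ⟨Finset.univ.sup fun l => pushCount (tm.m l), fun x y t h => ?_⟩
  set c := Finset.univ.sup fun l => pushCount (tm.m l)
  obtain ⟨m, hm, e⟩ := outputs_iff.1 h
  have key : ∀ m (a b : TM2.Cfg tm.Γ tm.Λ tm.σ),
      (flip bind (TM2.step tm.m))^[m] (some a) = some b →
      (b.stk tm.k₁).length ≤ (a.stk tm.k₁).length + m * c := by
    intro m
    induction m with
    | zero => intro a b h; cases h; simp
    | succ m ih =>
      intro a b h
      rw [Function.iterate_succ_apply'] at h
      obtain ⟨b', hb', hb⟩ := Option.bind_eq_some_iff.1 h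
      refine le_trans ?_ (Nat.add_le_add_right (ih a b' hb') c |>.trans
        (by rw [add_assoc, Nat.succ_mul]))
      rcases b' with ⟨_ | l, v, S⟩
      · cases hb
      · cases hb
        refine (length_stepAux_le _ _ _ _).trans ?_
        have : pushCount (tm.m l) ≤ c :=
          Finset.le_sup (f := fun l => pushCount (tm.m l)) (Finset.mem_univ l)
        simpa using this
  refine (by simpa using key m _ _ e : y.length ≤ _).trans ?_
  gcongr
  by_cases h : tm.k₁ = tm.k₀
  · rw [h]; simp
  · simp [h]

end Growth

/-! ### Calling machines -/

section Call

variable {R : Type} {ι : Type} {ΓR : R → Type} {M : ι → FinTM2} {τ : Type}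

/-- The alphabets of the stacks of a machine with its own stacks `R`, that uses the machines
`M i`, each with stacks of its own. -/
@[reducible] def CallΓ (ΓR : R → Type) (M : ι → FinTM2) : R ⊕ (Σ i, (M i).K) → Type
  | .inl r => ΓR r
  | .inr x => (M x.1).Γ x.2

/-- The stacks with contents `ρ` and, for the machines that are called, `F`. -/
def stk (ρ : ∀ r, List (ΓR r)) (F : ∀ i k, List ((M i).Γ k)) : ∀ k, List (CallΓ ΓR M k)
  | .inl r => ρ r
  | .inr ⟨i, k⟩ => F i k

@[simp] theorem stk_inl (ρ : ∀ r, List (ΓR r)) (F : ∀ i k, List ((M i).Γ k)) (r : R) :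
    stk ρ F (.inl r) = ρ r := rfl

@[simp] theorem stk_inr (ρ : ∀ r, List (ΓR r)) (F : ∀ i k, List ((M i).Γ k)) (i : ι)
    (k : (M i).K) : stk ρ F (.inr ⟨i, k⟩) = F i k := rfl

section
variable [DecidableEq R] [DecidableEq ι]

@[simp] theorem update_stk_inl (ρ : ∀ r, List (ΓR r)) (F : ∀ i k, List ((M i).Γ k)) (r : R)
    (x : List (ΓR r)) :
    Function.update (stk ρ F) (.inl r) x = stk (Function.update ρ r x) F := by
  funext k
  rcases k with k | ⟨i, k⟩
  · by_cases h : k = r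
    · subst h; simp
    · simp [h]
  · simp

@[simp] theorem update_stk_inr (ρ : ∀ r, List (ΓR r)) (F : ∀ i k, List ((M i).Γ k)) (i : ι)
    (k : (M i).K) (x : List ((M i).Γ k)) :
    Function.update (stk ρ F) (.inr ⟨i, k⟩) x =
      stk ρ (Function.update F i (Function.update (F i) k x)) := by
  funext k'
  rcases k' with k' | ⟨j, k'⟩
  · simp
  · by_cases h : j = i
    · subst h
      by_cases h : k' = k
      · subst h; simp
      · have : (⟨j, k'⟩ : Σ i, (M i).K) ≠ ⟨j, k⟩ := by simpa using h
        rw [Function.update_of_ne (by simpa using this)]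
        simp [h]
    · have : (⟨j, k'⟩ : Σ i, (M i).K) ≠ ⟨i, k⟩ := fun e => h (congrArg Sigma.fst e)
      rw [Function.update_of_ne (by simpa using this)]
      simp [h]

end

/-- The statement `q` of the machine `M i` as a statement of a machine that calls `M i`.
Halting becomes a jump to `exit`. -/
def liftStmt [DecidableEq ι] (ΓR : R → Type) (i : ι) {Λ : Type} (inj : (M i).Λ → Λ) (exit : Λ) :
    TM2.Stmt (M i).Γ (M i).Λ (M i).σ → TM2.Stmt (CallΓ ΓR M) Λ (τ × ∀ i, (M i).σ)
  | .push k f q => .push (.inr ⟨i, k⟩) (fun v => f (v.2 i)) (liftStmt ΓR i inj exit q)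
  | .peek k f q => .peek (.inr ⟨i, k⟩) (fun v o => (v.1, Function.update v.2 i (f (v.2 i) o)))
      (liftStmt ΓR i inj exit q)
  | .pop k f q => .pop (.inr ⟨i, k⟩) (fun v o => (v.1, Function.update v.2 i (f (v.2 i) o)))
      (liftStmt ΓR i inj exit q)
  | .load f q => .load (fun v => (v.1, Function.update v.2 i (f (v.2 i))))
      (liftStmt ΓR i inj exit q)
  | .branch b q₁ q₂ => .branch (fun v => b (v.2 i)) (liftStmt ΓR i inj exit q₁)
      (liftStmt ΓR i inj exit q₂)
  | .goto f => .goto fun v => inj (f (v.2 i))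
  | .halt => .goto fun _ => exit

/-- The fragment that runs the machine `M i`. -/
def call [DecidableEq ι] (ΓR : R → Type) (M : ι → FinTM2) (i : ι) :
    Frag (CallΓ ΓR M) (τ × ∀ i, (M i).σ) where
  L := (M i).Λ
  fin := (M i).ΛFin
  entry := (M i).main
  code inj exit l := liftStmt ΓR i inj exit ((M i).m l)

variable [DecidableEq R] [DecidableEq ι]

theorem stepAux_liftStmt (i : ι) {Λ : Type} (inj : (M i).Λ → Λ) (exit : Λ)
    (q : TM2.Stmt (M i).Γ (M i).Λ (M i).σ) (w : τ) (v : ∀ i, (M i).σ) (ρ : ∀ r, List (ΓR r))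
    (F : ∀ i k, List ((M i).Γ k)) :
    TM2.stepAux (liftStmt ΓR i inj exit q) (w, v) (stk ρ F) =
      let c := TM2.stepAux q (v i) (F i)
      ⟨some (c.l.elim exit inj), (w, Function.update v i c.var),
        stk ρ (Function.update F i c.stk)⟩ := by
  induction q generalizing v F with
  | push k f q ih => simp [liftStmt, ih]
  | peek k f q ih => simp [liftStmt, ih]
  | pop k f q ih => simp [liftStmt, ih]
  | load f q ih => simp [liftStmt, ih]
  | branch b q₁ q₂ ih₁ ih₂ =>
    simp only [liftStmt, TM2.stepAux]
    cases b (v i)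
    · simpa using ih₂ v F
    · simpa using ih₁ v F
  | goto f => simp [liftStmt]
  | halt => simp [liftStmt]

/-- A call replaces the input on the stacks of the machine by its output and takes as long as the
machine does. A machine halts in its initial state, so it can be called again. -/
theorem call_runs (i : ι) {x : List ((M i).Γ (M i).k₀)} {y : List ((M i).Γ (M i).k₁)} {t : ℕ}
    (h : Outputs (M i) x y t) {w : τ} {v : ∀ i, (M i).σ} (hv : v i = (M i).initialState)
    {ρ : ∀ r, List (ΓR r)} {F : ∀ i k, List ((M i).Γ k)}
    (hF : F i = Function.update (fun _ => []) (M i).k₀ x) :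
    (call ΓR M i).Runs (w, v) (stk ρ F) (w, v)
      (stk ρ (Function.update F i (Function.update (fun _ => []) (M i).k₁ y))) t := by
  intro Λ P inj exit hP
  obtain ⟨m, hm, e⟩ := outputs_iff.1 h
  have key : ∀ m (b : TM2.Cfg (M i).Γ (M i).Λ (M i).σ),
      (flip bind (TM2.step (M i).m))^[m]
        (some ⟨some (M i).main, (M i).initialState, Function.update (fun _ => []) (M i).k₀ x⟩) =
        some b →
      (flip bind (TM2.step P))^[m] (some ⟨some (inj (M i).main), (w, v), stk ρ F⟩) =
        some ⟨some (b.l.elim exit inj), (w, Function.update v i b.var),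
          stk ρ (Function.update F i b.stk)⟩ := by
    intro m
    induction m with
    | zero =>
      intro b h
      cases h
      simp only [Function.iterate_zero, id, ← hv, ← hF, Function.update_eq_self]
      rfl
    | succ m ih =>
      intro b h
      rw [Function.iterate_succ_apply'] at h ⊢
      obtain ⟨b', hb', hb⟩ := Option.bind_eq_some_iff.1 h
      rw [ih b' hb']
      rcases b' with ⟨_ | l, u, S⟩
      · cases hb
      · cases hb
        change some (TM2.stepAux (P (inj l)) _ _) = _
        rw [hP l]
        refine congrArg some ((stepAux_liftStmt i inj exit _ _ _ _ _).trans ?_)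
        simp
  refine ⟨m, hm, ?_⟩
  have := key m _ e
  simp only [Option.elim, ← hv, Function.update_eq_self] at this
  exact this

end Call

/-! ### Encoded types and polynomial-time functions -/

/-- An encoding of the elements of a type as strings over a finite nonempty alphabet. Nothing
requires it to be injective: a function that is compatible with the encodings is meant to be a
function of the strings. -/
class Enc (α : Type) : Type 1 where
  /-- The alphabet. -/
  Γ : Type
  fin : Fintype Γ
  inh : Inhabited Γ
  /-- The code of an element. -/
  enc : α → List Γ

attribute [reducible, instance] Enc.fin Enc.inh

open Enc (enc)

/-- The length of the encoding. -/
abbrev size {α : Type} [Enc α] (a : α) : ℕ := (enc a).length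

/-- Some Turing machine turns encodings of `a` into encodings of `f a` in polynomial time. As `α`
may be a subtype, this covers promise problems. -/
def Poly {α β : Type} [Enc α] [Enc β] (f : α → β) : Prop :=
  Nonempty (TM2ComputableInPolyTime (enc (α := α)) (enc (α := β)) f)

/-- Only the encodings matter. -/
theorem computable_congr {α β α' β' Γ Γ' : Type} {ea : α → List Γ} {eb : β → List Γ'} {f : α → β}
    {ea' : α' → List Γ} {eb' : β' → List Γ'} {g : α' → β'}
    (hf : Nonempty (TM2ComputableInPolyTime ea eb f)) (i : α' → α) (hi : ∀ a, ea' a = ea (i a))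
    (ho : ∀ a, eb' (g a) = eb (f (i a))) : Nonempty (TM2ComputableInPolyTime ea' eb' g) := by
  obtain ⟨h⟩ := hf
  exact ⟨⟨h.toTM2ComputableAux, h.time, fun a => by rw [hi, ho]; exact h.outputsFun (i a)⟩⟩

theorem eval_mono (p : Polynomial ℕ) {m n : ℕ} (h : m ≤ n) : p.eval m ≤ p.eval n := by
  rw [Polynomial.eval_eq_sum_range, Polynomial.eval_eq_sum_range]
  gcongr

section Basic

variable {α β γ δ : Type} [Enc α] [Enc β] [Enc γ] [Enc δ]

/-- A machine that computes `f`, with the translations of the alphabets of the encodings to and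
from those of its stacks. -/
theorem Poly.elim {f : α → β} (hf : Poly f) :
    ∃ (tm : FinTM2) (i : Enc.Γ α → tm.Γ tm.k₀) (o : tm.Γ tm.k₁ → Enc.Γ β) (p : Polynomial ℕ),
      ∀ a, ∃ y, y.map o = enc (f a) ∧ Outputs tm ((enc a).map i) y (p.eval (size a)) := by
  obtain ⟨h⟩ := hf
  refine ⟨h.tm, h.inputAlphabet.invFun, h.outputAlphabet, h.time, fun a =>
    ⟨_, ?_, ⟨h.outputsFun a⟩⟩⟩
  simp

/-- A program computes `f` in polynomial time if it turns the code of `a` on the stack `k₀` into the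
code of `f a` on `k₁`, leaves the other stacks empty, and restores the internal state. -/
theorem Poly.of_runs {K : Type} [DecidableEq K] [Fintype K] {Γ : K → Type} {σ : Type} [Fintype σ]
    {k₀ k₁ : K} (e₀ : Γ k₀ ≃ Enc.Γ α) (e₁ : Γ k₁ ≃ Enc.Γ β) {v : σ} {c : Frag Γ σ} {f : α → β}
    (p : Polynomial ℕ)
    (h : ∀ a, c.Runs v (Function.update (fun _ => []) k₀ ((enc a).map e₀.symm)) v
      (Function.update (fun _ => []) k₁ ((enc (f a)).map e₁.symm)) (p.eval (size a))) :
    Poly f := by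
  let _ : Fintype (Γ k₀) := Fintype.ofEquiv _ e₀.symm
  refine ⟨⟨⟨c.toFinTM2 k₀ k₁ v, e₀, e₁⟩, p + 1, fun a => Classical.choice ?_⟩⟩
  rw [Polynomial.eval_add, Polynomial.eval_one]
  exact (h a).outputs

/-- The output of a polynomial-time function has polynomial length. -/
theorem Poly.exists_size_le {f : α → β} (hf : Poly f) :
    ∃ p : Polynomial ℕ, ∀ a, size (f a) ≤ p.eval (size a) := by
  obtain ⟨tm, i, o, p, h⟩ := hf.elim
  obtain ⟨c, hc⟩ := exists_length_output_le tm
  refine ⟨.X + p * .C c, fun a => ?_⟩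
  obtain ⟨y, hy, hO⟩ := h a
  have := hc _ _ _ hO
  rw [size, ← hy]
  simpa using this

end Basic

instance : Enc Bool where
  Γ := Bool
  fin := inferInstance
  inh := inferInstance
  enc b := [b]

/-- A pair is encoded by the codes of its components over disjoint alphabets. -/
instance {α β : Type} [Enc α] [Enc β] : Enc (α × β) where
  Γ := Enc.Γ α ⊕ Enc.Γ β
  fin := inferInstance
  inh := inferInstance
  enc x := (enc x.1).map .inl ++ (enc x.2).map .inr

/-- A list is encoded by the codes of its elements, each followed by the separator `none`. -/
instance {α : Type} [Enc α] : Enc (List α) where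
  Γ := Option (Enc.Γ α)
  fin := inferInstance
  inh := inferInstance
  enc l := l.flatMap fun a => (enc a).map some ++ [none]

theorem enc_bool (b : Bool) : enc b = [b] := rfl

theorem enc_prod {α β : Type} [Enc α] [Enc β] (x : α × β) :
    enc x = (enc x.1).map .inl ++ (enc x.2).map .inr := rfl

@[simp] theorem enc_nil {α : Type} [Enc α] : enc ([] : List α) = [] := rfl

theorem enc_cons {α : Type} [Enc α] (a : α) (l : List α) :
    enc (a :: l) = (enc a).map some ++ none :: enc l := by
  simp [enc]

theorem enc_append {α : Type} [Enc α] (l l' : List α) : enc (l ++ l') = enc l ++ enc l' := by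
  simp [enc]

@[simp] theorem size_bool (b : Bool) : size b = 1 := rfl

@[simp] theorem size_prod {α β : Type} [Enc α] [Enc β] (x : α × β) :
    size x = size x.1 + size x.2 := by
  simp [size, enc_prod]

@[simp] theorem size_nil {α : Type} [Enc α] : size ([] : List α) = 0 := rfl

@[simp] theorem size_cons {α : Type} [Enc α] (a : α) (l : List α) :
    size (a :: l) = size a + 1 + size l := by
  simp [size, enc_cons]; omega

@[simp] theorem size_append {α : Type} [Enc α] (l l' : List α) :
    size (l ++ l') = size l + size l' := by
  simp [size, enc_append]

theorem length_le_size {α : Type} [Enc α] (l : List α) : l.length ≤ size l := by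
  induction l with
  | nil => simp
  | cons a l ih => simp only [List.length_cons, size_cons]; omega

theorem size_le_of_mem {α : Type} [Enc α] {a : α} {l : List α} (h : a ∈ l) :
    size a ≤ size l := by
  induction l with
  | nil => cases h
  | cons b l ih =>
    rw [size_cons]
    rcases List.mem_cons.1 h with rfl | h
    · omega
    · have := ih h; omega

/-! ### Composition and pairing -/

section Transfer

variable {K : Type} [DecidableEq K] {Γ : K → Type} {A τ : Type} [Inhabited A]

/-- Move the string on the stack `k` to the stack `k'` without reversing it, by way of `m`. -/
def transfer (k m k' : K) (h : Γ k → A) (g : A → Γ m) (h' : Γ m → A) (g' : A → Γ k') :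
    Frag Γ (Option A × τ) :=
  (Frag.move k m h g).seq (Frag.move m k' h' g')

theorem transfer_runs {k m k' : K} (h₁ : k ≠ m) (h₂ : m ≠ k') (h₃ : k ≠ k') {h : Γ k → A}
    {g : A → Γ m} {h' : Γ m → A} {g' : A → Γ k'} (hg : ∀ a, h' (g a) = a) {x : List (Γ k)}
    {o : Option A} {w : τ} {S S' : ∀ k, List (Γ k)} (hx : S k = x) (hm : S m = [])
    (hS' : S' = Function.update (Function.update S k []) k' ((x.map fun a => g' (h a)) ++ S k'))
    {t : ℕ} (ht : 2 * x.length + 2 ≤ t) :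
    (transfer k m k' h g h' g').Runs (o, w) S (none, w) S' t := by
  refine Frag.Runs.mono ((Frag.move_runs h₁ hx rfl).seq (Frag.move_runs h₂ rfl ?_)) ?_
  · subst hS'
    funext j
    by_cases e₁ : j = k'
    · subst e₁; simp [hm, h₂.symm, h₃.symm, hg, Function.comp_def]
    by_cases e₂ : j = m
    · subst e₂; simp [hm, h₁.symm, e₁]
    by_cases e₃ : j = k
    · subst e₃; simp [e₁, e₂]
    · simp [e₁, e₂, e₃]
  · simp [hm]; omega

end Transfer

/-- Own stacks of the machines that compose or pair two given machines: the input, the output, and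
an auxiliary stack. -/
inductive Reg | inp | mid | out
  deriving DecidableEq

instance : Fintype Reg := ⟨{.inp, .mid, .out}, fun r => by cases r <;> simp⟩

/-- The alphabets of the stacks `Reg`. -/
@[reducible] def RegΓ (A B C : Type) : Reg → Type
  | .inp => A
  | .mid => B
  | .out => C

/-- Contents of the stacks `Reg`. -/
def regs {A B C : Type} (a : List A) (b : List B) (c : List C) : ∀ r, List (RegΓ A B C r)
  | .inp => a
  | .mid => b
  | .out => c

section
variable {A B C : Type} (a x : List A) (b y : List B) (c z : List C)
@[simp] theorem regs_inp : regs a b c .inp = a := rfl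
@[simp] theorem regs_mid : regs a b c .mid = b := rfl
@[simp] theorem regs_out : regs a b c .out = c := rfl
@[simp] theorem update_regs_inp : Function.update (regs a b c) .inp x = regs x b c := by
  funext r; cases r <;> simp
@[simp] theorem update_regs_mid : Function.update (regs a b c) .mid y = regs a y c := by
  funext r; cases r <;> simp
@[simp] theorem update_regs_out : Function.update (regs a b c) .out z = regs a b z := by
  funext r; cases r <;> simp
end

/-- The family of two machines. -/
@[reducible] def pairM (M N : FinTM2) : Bool → FinTM2
  | false => M
  | true => N

/-- Contents of the stacks of two machines. -/
def pairF {M N : FinTM2} (S : ∀ k, List (M.Γ k)) (T : ∀ k, List (N.Γ k)) :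
    ∀ i k, List ((pairM M N i).Γ k)
  | false => S
  | true => T

section
variable {M N : FinTM2} (S S' : ∀ k, List (M.Γ k)) (T T' : ∀ k, List (N.Γ k))
@[simp] theorem pairF_false : pairF S T false = S := rfl
@[simp] theorem pairF_true : pairF S T true = T := rfl
@[simp] theorem update_pairF_false : Function.update (pairF S T) false S' = pairF S' T := by
  funext r; cases r <;> simp
@[simp] theorem update_pairF_true : Function.update (pairF S T) true T' = pairF S T' := by
  funext r; cases r <;> simp
end

theorem Frag.Runs.congr_stk {K : Type} [DecidableEq K] {Γ : K → Type} {σ : Type} {c : Frag Γ σ}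
    {v v' : σ} {S S' S'' : ∀ k, List (Γ k)} {t : ℕ} (h : c.Runs v S v' S' t) (e : S' = S'') :
    c.Runs v S v' S'' t := e ▸ h

instance (M : FinTM2) : Fintype M.σ := M.σFin
instance (M : FinTM2) : Fintype M.K := M.kFin

/-- All stacks of a machine empty. -/
abbrev noStk (M : FinTM2) : ∀ k, List (M.Γ k) := fun _ => []

/-- The stacks of a machine with the own stacks `Reg` that calls `M` and `N`. -/
abbrev BinK (M N : FinTM2) : Type := Reg ⊕ (Σ i, (pairM M N i).K)

/-- The own stack `r`. -/
abbrev kReg {M N : FinTM2} (r : Reg) : BinK M N := .inl r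
/-- The stack `k` of the first machine. -/
abbrev kFst {M N : FinTM2} (k : M.K) : BinK M N := .inr ⟨false, k⟩
/-- The stack `k` of the second machine. -/
abbrev kSnd {M N : FinTM2} (k : N.K) : BinK M N := .inr ⟨true, k⟩

/-- The alphabets of these stacks. -/
abbrev BinΓ (A B C : Type) (M N : FinTM2) : BinK M N → Type :=
  CallΓ (RegΓ A B C) (pairM M N)

/-- Contents of these stacks. -/
abbrev binStk {A B C : Type} {M N : FinTM2} (a : List A) (b : List B) (c : List C)
    (S : ∀ k, List (M.Γ k)) (T : ∀ k, List (N.Γ k)) : ∀ k, List (BinΓ A B C M N k) :=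
  stk (regs a b c) (pairF S T)

theorem binStk_inp {A B C : Type} {M N : FinTM2} (x : List A) :
    Function.update (β := fun k => List (BinΓ A B C M N k)) (fun _ => []) (kReg .inp) x =
      binStk x [] [] (noStk M) (noStk N) := by
  funext k
  rcases k with (_ | _ | _) | ⟨_ | _, k⟩ <;> simp

theorem binStk_out {A B C : Type} {M N : FinTM2} (x : List C) :
    Function.update (β := fun k => List (BinΓ A B C M N k)) (fun _ => []) (kReg .out) x =
      binStk [] [] x (noStk M) (noStk N) := by
  funext k
  rcases k with (_ | _ | _) | ⟨_ | _, k⟩ <;> simp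

/-- The internal states of such a machine: a symbol under way, and the states of the machines that
are called. -/
abbrev Binσ (B : Type) (M N : FinTM2) : Type := Option B × ∀ i, (pairM M N i).σ

/-- The initial state. -/
abbrev binInit {B : Type} {M N : FinTM2} : Binσ B M N :=
  (none, fun i => (pairM M N i).initialState)

/-- The program that calls `M` and then `N` on the output of `M`. -/
def compFrag {A B C : Type} [Inhabited A] [Inhabited B] [Inhabited C] (M N : FinTM2)
    (i : A → M.Γ M.k₀) (o : M.Γ M.k₁ → B) (j : B → N.Γ N.k₀) (u : N.Γ N.k₁ → C) :
    Frag (BinΓ A (A × B × C) C M N) (Binσ (A × B × C) M N) :=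
  (transfer (kReg .inp) (kReg .mid) (kFst M.k₀) (fun x => (x, default)) id id
    (fun a => i a.1)).seq <|
  (call _ (pairM M N) false).seq <|
  (transfer (kFst M.k₁) (kReg .mid) (kSnd N.k₀) (fun x => (default, o x, default)) id id
    (fun a => j a.2.1)).seq <|
  (call _ (pairM M N) true).seq <|
  transfer (kSnd N.k₁) (kReg .mid) (kReg .out) (fun x => (default, default, u x)) id id
    (fun a => a.2.2)

theorem compFrag_runs {A B C : Type} [Inhabited A] [Inhabited B] [Inhabited C] {M N : FinTM2}
    {i : A → M.Γ M.k₀} {o : M.Γ M.k₁ → B} {j : B → N.Γ N.k₀} {u : N.Γ N.k₁ → C}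
    {x : List A} {y : List (M.Γ M.k₁)} {z : List (N.Γ N.k₁)} {s t : ℕ}
    (hM : Outputs M (x.map i) y s) (hN : Outputs N ((y.map o).map j) z t) :
    (compFrag M N i o j u).Runs binInit (binStk x [] [] (noStk M) (noStk N))
      binInit (binStk [] [] (z.map u) (noStk M) (noStk N))
      ((2 * x.length + 2) + (s + ((2 * y.length + 2) + (t + (2 * z.length + 2))))) := by
  unfold compFrag
  refine Frag.Runs.seq (transfer_runs (by simp) (by simp) (by simp) (fun _ => rfl) (x := x) rfl rfl
      (S' := binStk [] [] [] (Function.update (noStk M) M.k₀ (x.map i)) (noStk N)) ?_ le_rfl) <|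
    Frag.Runs.seq (v₁ := binInit)
      (S₁ := binStk [] [] [] (Function.update (noStk M) M.k₁ y) (noStk N)) ?_ <|
    Frag.Runs.seq (transfer_runs (k := kFst M.k₁) (x := y) (by simp) (by simp) (by simp)
      (fun _ => rfl) (by simp) rfl
      (S' := binStk [] [] [] (noStk M) (Function.update (noStk N) N.k₀ ((y.map o).map j)))
      ?_ le_rfl) <|
    Frag.Runs.seq (v₁ := binInit)
      (S₁ := binStk [] [] [] (noStk M) (Function.update (noStk N) N.k₁ z)) ?_ <|
    transfer_runs (k := kSnd N.k₁) (x := z) (by simp) (by simp) (by simp) (fun _ => rfl)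
      (by simp) rfl ?_ le_rfl
  · simp
  · exact (call_runs (M := pairM M N) false hM rfl rfl).congr_stk (by simp)
  · simp [Function.comp_def]
  · exact (call_runs (M := pairM M N) true hN rfl rfl).congr_stk (by simp)
  · simp

section Comp

variable {α β γ δ : Type} [Enc α] [Enc β] [Enc γ] [Enc δ]

theorem Poly.comp {g : β → γ} {f : α → β} (hg : Poly g) (hf : Poly f) :
    Poly fun a => g (f a) := by
  obtain ⟨s, hs⟩ := hf.exists_size_le
  obtain ⟨r, hr⟩ := hg.exists_size_le
  obtain ⟨M, i, o, p, hM⟩ := hf.elim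
  obtain ⟨N, j, u, q, hN⟩ := hg.elim
  refine Poly.of_runs (k₀ := kReg .inp) (k₁ := kReg .out) (Equiv.refl _) (Equiv.refl _)
    (v := binInit) (c := compFrag M N i o j u)
    ((2 * .X + 2) + (p + ((2 * s + 2) + (q.comp s + (2 * r.comp s + 2))))) fun a => ?_
  obtain ⟨y, hy, hMy⟩ := hM a
  obtain ⟨z, hz, hNz⟩ := hN (f a)
  have hyl : y.length = size (f a) := by rw [size, ← hy, List.length_map]
  have hzl : z.length = size (g (f a)) := by rw [size, ← hz, List.length_map]
  have h₁ := hs a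
  have h₂ := (hr (f a)).trans (eval_mono r h₁)
  have h₃ := eval_mono q h₁
  rw [← hy] at hNz
  have := compFrag_runs (u := u) hMy hNz
  rw [hz, ← binStk_inp, ← binStk_out] at this
  simp only [Polynomial.eval_add, Polynomial.eval_mul, Polynomial.eval_X, Polynomial.eval_ofNat,
    Polynomial.eval_comp]
  refine (by simpa using this : Frag.Runs _ _ _ _ _ _).mono ?_
  simp only [size] at *
  omega

end Comp

/-- The program that calls `M` and `N` on the same input and concatenates the outputs. -/
def pairFrag {A B C : Type} [Inhabited A] [Inhabited B] [Inhabited C] (M N : FinTM2)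
    (i : A → M.Γ M.k₀) (o : M.Γ M.k₁ → B) (j : A → N.Γ N.k₀) (u : N.Γ N.k₁ → C) :
    Frag (BinΓ A (A × (B ⊕ C)) (B ⊕ C) M N) (Binσ (A × (B ⊕ C)) M N) :=
  (Frag.move (kReg .inp) (kReg .mid) (fun x => (x, default)) id).seq <|
  (Frag.move₂ (kReg .mid) (kFst M.k₀) (kSnd N.k₀) id (fun a => i a.1) (fun a => j a.1)).seq <|
  (call _ (pairM M N) false).seq <|
  (call _ (pairM M N) true).seq <|
  (transfer (kSnd N.k₁) (kReg .mid) (kReg .out) (fun x => (default, .inr (u x))) id id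
    (fun a => a.2)).seq <|
  transfer (kFst M.k₁) (kReg .mid) (kReg .out) (fun x => (default, .inl (o x))) id id
    (fun a => a.2)

theorem pairFrag_runs {A B C : Type} [Inhabited A] [Inhabited B] [Inhabited C] {M N : FinTM2}
    {i : A → M.Γ M.k₀} {o : M.Γ M.k₁ → B} {j : A → N.Γ N.k₀} {u : N.Γ N.k₁ → C}
    {x : List A} {y : List (M.Γ M.k₁)} {z : List (N.Γ N.k₁)} {s t : ℕ}
    (hM : Outputs M (x.map i) y s) (hN : Outputs N (x.map j) z t) :
    (pairFrag M N i o j u).Runs binInit (binStk x [] [] (noStk M) (noStk N))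
      binInit (binStk [] [] ((y.map o).map .inl ++ (z.map u).map .inr) (noStk M) (noStk N))
      ((x.length + 1) + ((x.length + 1) +
        (s + (t + ((2 * z.length + 2) + (2 * y.length + 2)))))) := by
  unfold pairFrag
  refine Frag.Runs.seq (Frag.move_runs (k := kReg .inp) (x := x) (by simp) rfl
      (S' := binStk [] (x.map fun a => (a, default)).reverse [] (noStk M) (noStk N)) ?_) <|
    Frag.Runs.seq ((Frag.move₂_runs (k := kReg .mid) (x := (x.map fun a => (a, default)).reverse)
      (by simp) (by simp) (by simp) rfl
      (S' := binStk [] [] [] (Function.update (noStk M) M.k₀ (x.map i))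
        (Function.update (noStk N) N.k₀ (x.map j))) ?_).mono (by simp)) <|
    Frag.Runs.seq (v₁ := binInit) (S₁ := binStk [] [] [] (Function.update (noStk M) M.k₁ y)
      (Function.update (noStk N) N.k₀ (x.map j))) ?_ <|
    Frag.Runs.seq (v₁ := binInit) (S₁ := binStk [] [] [] (Function.update (noStk M) M.k₁ y)
      (Function.update (noStk N) N.k₁ z)) ?_ <|
    Frag.Runs.seq (transfer_runs (k := kSnd N.k₁) (x := z) (by simp) (by simp) (by simp)
      (fun _ => rfl) (by simp) rfl
      (S' := binStk [] [] ((z.map u).map .inr) (Function.update (noStk M) M.k₁ y) (noStk N))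
      ?_ le_rfl) <|
    transfer_runs (k := kFst M.k₁) (x := y) (by simp) (by simp) (by simp)
      (fun _ => rfl) (by simp) rfl ?_ le_rfl
  · simp
  · simp [Function.comp_def]
  · exact (call_runs (M := pairM M N) false hM rfl rfl).congr_stk (by simp)
  · exact (call_runs (M := pairM M N) true hN rfl rfl).congr_stk (by simp)
  · simp [Function.comp_def]
  · simp [Function.comp_def]

theorem Poly.pair {α β γ : Type} [Enc α] [Enc β] [Enc γ] {f : α → β} {g : α → γ} (hf : Poly f)
    (hg : Poly g) : Poly fun a => (f a, g a) := by
  obtain ⟨s, hs⟩ := hf.exists_size_le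
  obtain ⟨r, hr⟩ := hg.exists_size_le
  obtain ⟨M, i, o, p, hM⟩ := hf.elim
  obtain ⟨N, j, u, q, hN⟩ := hg.elim
  refine Poly.of_runs (k₀ := kReg .inp) (k₁ := kReg .out) (Equiv.refl _) (Equiv.refl _)
    (v := binInit) (c := pairFrag M N i o j u)
    ((.X + 1) + ((.X + 1) + (p + (q + ((2 * r + 2) + (2 * s + 2)))))) fun a => ?_
  obtain ⟨y, hy, hMy⟩ := hM a
  obtain ⟨z, hz, hNz⟩ := hN a
  have hyl : y.length = size (f a) := by rw [size, ← hy, List.length_map]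
  have hzl : z.length = size (g a) := by rw [size, ← hz, List.length_map]
  have h₁ := hs a
  have h₂ := hr a
  have := pairFrag_runs (o := o) (u := u) hMy hNz
  rw [hz, hy, ← enc_prod (f a, g a), ← binStk_inp, ← binStk_out] at this
  simp only [Polynomial.eval_add, Polynomial.eval_mul, Polynomial.eval_X, Polynomial.eval_ofNat,
    Polynomial.eval_one]
  erw [List.map_id, List.map_id]
  refine this.mono ?_
  simp only [size] at *
  omega

/-! ### Finite-state transducers -/

section Transducer

/-- The output of a transducer that starts in the state `q`: it reads the string from left to
right, emits `(step q a).2` when it reads `a` in the state `q`, and `flush q` at the end. -/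
def transduce {Q A B : Type} (step : Q → A → Q × List B) (flush : Q → List B) :
    Q → List A → List B
  | q, [] => flush q
  | q, a :: l => (step q a).2 ++ transduce step flush (step q a).1 l

/-- A statement that pushes the first `n` symbols of the string `o v`, where `v` is the internal
state, one after the other, and then does `q`. -/
def pushList {K : Type} {Γ : K → Type} {Λ σ : Type} (k : K) (o : σ → List (Γ k)) [Inhabited (Γ k)] :
    ℕ → TM2.Stmt Γ Λ σ → TM2.Stmt Γ Λ σ
  | 0, q => q
  | n + 1, q => pushList k o n (.branch (fun v => n < (o v).length)
      (.push k (fun v => (o v).getD n default) q) q)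

theorem stepAux_pushList {K : Type} [DecidableEq K] {Γ : K → Type} {Λ σ : Type} (k : K)
    (o : σ → List (Γ k)) [Inhabited (Γ k)] (n : ℕ) (q : TM2.Stmt Γ Λ σ) (v : σ)
    (S : ∀ k, List (Γ k)) :
    TM2.stepAux (pushList k o n q) v S =
      TM2.stepAux q v (Function.update S k (((o v).take n).reverse ++ S k)) := by
  induction n generalizing q with
  | zero => simp [pushList]
  | succ n ih =>
    rw [pushList, ih]
    by_cases h : n < (o v).length
    · have e : (o v).take (n + 1) = (o v).take n ++ [(o v)[n]] := by simp
      simp only [TM2.stepAux, h, decide_true, cond_true, Function.update_self,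
        Function.update_idem, e, List.reverse_append, List.reverse_singleton, List.cons_append, List.nil_append,
        List.getD_eq_getElem]
    · rw [List.take_of_length_le (by omega : (o v).length ≤ n),
        List.take_of_length_le (by omega : (o v).length ≤ n + 1)]
      simp [h]

variable {Q A B : Type} [Inhabited A] [Inhabited B]

/-- The program of a transducer. `N` bounds the lengths of the strings emitted in one step. -/
def transduceFrag (step : Q → A → Q × List B) (flush : Q → List B) (N : ℕ) (q₀ : Q) :
    Frag (RegΓ A B B) (Option (A × B) × Q) :=
  (Frag.rep fun self exit =>
    .pop Reg.inp (fun v o => (o.map fun a => (a, default), v.2)) <|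
      .branch (fun v => v.1.isSome)
        (pushList Reg.mid (fun v => (step v.2 (v.1.getD default).1).2) N <|
          .load (fun v => (v.1, (step v.2 (v.1.getD default).1).1)) <| .goto fun _ => self)
        (pushList Reg.mid (fun v => flush v.2) N <| .load (fun v => (v.1, q₀)) <|
          .goto fun _ => exit)).seq <|
  Frag.move Reg.mid Reg.out (fun b => (default, b)) (fun a => a.2)

theorem transduceFrag_runs {step : Q → A → Q × List B} {flush : Q → List B} {N : ℕ} {q₀ : Q}
    (hs : ∀ q a, (step q a).2.length ≤ N) (hf : ∀ q, (flush q).length ≤ N) (x : List A) :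
    (transduceFrag step flush N q₀).Runs (none, q₀) (regs x [] []) (none, q₀)
      (regs [] [] (transduce step flush q₀ x))
      ((x.length + 1) + ((transduce step flush q₀ x).length + 1)) := by
  have key : ∀ (x : List A) (q : Q) (o : Option (A × B)) (y : List B), (Frag.rep fun self exit =>
    .pop Reg.inp (fun v o => (o.map fun a => (a, default), v.2)) <|
      .branch (fun v => v.1.isSome)
        (pushList Reg.mid (fun v => (step v.2 (v.1.getD default).1).2) N <|
          .load (fun v => (v.1, (step v.2 (v.1.getD default).1).1)) <| .goto fun _ => self)
        (pushList Reg.mid (fun v => flush v.2) N <| .load (fun v => (v.1, q₀)) <|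
          .goto fun _ => exit) : Frag (RegΓ A B B) (Option (A × B) × Q)).Runs
      (o, q) (regs x y []) (none, q₀) (regs [] ((transduce step flush q x).reverse ++ y) [])
      (x.length + 1) := by
    intro x
    induction x with
    | nil =>
      intro q o y
      refine Frag.rep_exit fun self exit => ?_
      simp [stepAux_pushList, transduce, List.take_of_length_le (hf q)]
    | cons a x ih =>
      intro q o y
      refine Frag.rep_next (v₁ := (some (a, default), (step q a).1))
        (S₁ := regs x ((step q a).2.reverse ++ y) []) (fun self exit => ?_) ?_
      · simp [stepAux_pushList, List.take_of_length_le (hs q a)]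
      · have := ih (step q a).1 (some (a, default)) ((step q a).2.reverse ++ y)
        simpa [transduce] using this
  refine Frag.Runs.seq (key x q₀ none []) ?_
  refine (Frag.move_runs (k := Reg.mid) (k' := Reg.out) (by simp)
    (x := (transduce step flush q₀ x).reverse) (by simp) ?_).mono (by simp)
  simp

/-- A function computed by a finite-state transducer is computable in polynomial time. -/
theorem Poly.of_transduce {α β : Type} [Enc α] [Enc β] {f : α → β} [Finite Q] (q₀ : Q)
    (step : Q → Enc.Γ α → Q × List (Enc.Γ β)) (flush : Q → List (Enc.Γ β))
    (h : ∀ a, transduce step flush q₀ (enc a) = enc (f a)) : Poly f := by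
  have := Fintype.ofFinite Q
  obtain ⟨N, hs, hf⟩ : ∃ N, (∀ q a, (step q a).2.length ≤ N) ∧ ∀ q, (flush q).length ≤ N := by
    refine ⟨(Finset.univ.sup fun x : Q × Enc.Γ α => (step x.1 x.2).2.length) +
      Finset.univ.sup fun q => (flush q).length, fun q a => ?_, fun q => ?_⟩
    · exact (Finset.le_sup (f := fun x : Q × Enc.Γ α => (step x.1 x.2).2.length)
        (Finset.mem_univ (q, a))).trans (Nat.le_add_right _ _)
    · exact (Finset.le_sup (f := fun q => (flush q).length)
        (Finset.mem_univ q)).trans (Nat.le_add_left _ _)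
  have hl : ∀ (x : List (Enc.Γ α)) q, (transduce step flush q x).length ≤ N * x.length + N := by
    intro x
    induction x with
    | nil => intro q; simpa [transduce] using hf q
    | cons a x ih =>
      intro q
      have h₁ := hs q a
      have h₂ := ih (step q a).1
      rw [transduce, List.length_append, List.length_cons, Nat.mul_succ]
      omega
  refine Poly.of_runs (k₀ := Reg.inp) (k₁ := Reg.out) (Γ := RegΓ (Enc.Γ α) (Enc.Γ β) (Enc.Γ β))
    (Equiv.refl _) (Equiv.refl _) (v := (none, q₀)) (c := transduceFrag step flush N q₀)
    ((.X + 1) + (.C N * .X + .C N + 1)) fun a => ?_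
  have e : ∀ x : List (Enc.Γ α), Function.update (β := fun k => List (RegΓ _ _ _ k))
      (fun _ => []) Reg.inp x = regs x ([] : List (Enc.Γ β)) ([] : List (Enc.Γ β)) := by
    intro x; funext r; cases r <;> simp
  have e' : ∀ x : List (Enc.Γ β), Function.update (β := fun k => List (RegΓ _ _ _ k))
      (fun _ => []) Reg.out x = regs ([] : List (Enc.Γ α)) ([] : List (Enc.Γ β)) x := by
    intro x; funext r; cases r <;> simp
  have := transduceFrag_runs (q₀ := q₀) hs hf (enc a)
  rw [h, ← e, ← e'] at this
  refine (by simpa using this : Frag.Runs _ _ _ _ _ _).mono ?_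
  have := hl (enc a) q₀
  simp only [Polynomial.eval_add, Polynomial.eval_mul, Polynomial.eval_X, Polynomial.eval_C,
    Polynomial.eval_one, size, h] at *
  omega

end Transducer

/-! ### Folding over a list -/

section Fold

/-- Own stacks of the machine that folds a function over a list. -/
inductive FoldReg | inp | lst | elt | acc | mid | out
  deriving DecidableEq

instance : Fintype FoldReg := ⟨{.inp, .lst, .elt, .acc, .mid, .out}, fun r => by cases r <;> simp⟩

/-- Their alphabets. -/
@[reducible] def FoldΓ (A B : Type) : FoldReg → Type
  | .inp => B ⊕ Option A
  | .lst => Option A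
  | .elt => A
  | .acc => B
  | .mid => Option A
  | .out => B

/-- Their contents: the input, the list that remains, the current list element (reversed), the
accumulated value (reversed), and an auxiliary and the output stack. -/
def fregs {A B : Type} (x : List (B ⊕ Option A)) (l : List (Option A)) (e : List A) (b : List B)
    (m : List (Option A)) (z : List B) : ∀ r, List (FoldΓ A B r)
  | .inp => x
  | .lst => l
  | .elt => e
  | .acc => b
  | .mid => m
  | .out => z

section
variable {A B : Type} (x x' : List (B ⊕ Option A)) (l l' : List (Option A)) (e e' : List A)
  (b b' : List B) (m m' : List (Option A)) (z z' : List B)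
@[simp] theorem fregs_inp : fregs x l e b m z .inp = x := rfl
@[simp] theorem fregs_lst : fregs x l e b m z .lst = l := rfl
@[simp] theorem fregs_elt : fregs x l e b m z .elt = e := rfl
@[simp] theorem fregs_acc : fregs x l e b m z .acc = b := rfl
@[simp] theorem fregs_mid : fregs x l e b m z .mid = m := rfl
@[simp] theorem fregs_out : fregs x l e b m z .out = z := rfl
@[simp] theorem update_fregs_inp :
    Function.update (fregs x l e b m z) .inp x' = fregs x' l e b m z := by
  funext r; cases r <;> simp
@[simp] theorem update_fregs_lst :
    Function.update (fregs x l e b m z) .lst l' = fregs x l' e b m z := by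
  funext r; cases r <;> simp
@[simp] theorem update_fregs_elt :
    Function.update (fregs x l e b m z) .elt e' = fregs x l e' b m z := by
  funext r; cases r <;> simp
@[simp] theorem update_fregs_acc :
    Function.update (fregs x l e b m z) .acc b' = fregs x l e b' m z := by
  funext r; cases r <;> simp
@[simp] theorem update_fregs_mid :
    Function.update (fregs x l e b m z) .mid m' = fregs x l e b m' z := by
  funext r; cases r <;> simp
@[simp] theorem update_fregs_out :
    Function.update (fregs x l e b m z) .out z' = fregs x l e b m z' := by
  funext r; cases r <;> simp
end

variable {A B : Type} {M : FinTM2}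

/-- The stacks of the machine that folds the function computed by `M`. -/
abbrev FoldK (M : FinTM2) : Type := FoldReg ⊕ (Σ _ : Unit, M.K)

/-- The own stack `r`. -/
abbrev fReg (r : FoldReg) : FoldK M := .inl r
/-- The stack `k` of the machine that is called. -/
abbrev fMach (k : M.K) : FoldK M := .inr ⟨(), k⟩

/-- The alphabets of these stacks. -/
abbrev FoldAllΓ (A B : Type) (M : FinTM2) : FoldK M → Type := CallΓ (FoldΓ A B) (fun _ : Unit => M)

/-- The internal states: a symbol under way and the state of `M`. -/
abbrev Foldσ (A B : Type) (M : FinTM2) : Type := Option (B ⊕ Option A) × (Unit → M.σ)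

@[simp] theorem update_unit {X : Unit → Type} (f : ∀ u, X u) (x : X ()) :
    Function.update f () x = fun _ => x := by
  funext u; cases u; simp

/-- The list symbol in the first component of the internal state. -/
def listSym : Option (B ⊕ Option A) → Option A
  | some (.inr (some a)) => some a
  | _ => none

@[simp] theorem listSym_some (a : A) : listSym (B := B) (some (.inr (some a))) = some a := rfl
@[simp] theorem listSym_end : listSym (B := B) (A := A) (some (.inr none)) = none := rfl

variable [Inhabited A]

section
variable [Inhabited B]

/-- Separate the code of a pair into its components, which are reversed. -/
def splitFrag (A B : Type) [Inhabited A] [Inhabited B] (M : FinTM2) :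
    Frag (FoldAllΓ A B M) (Foldσ A B M) :=
  Frag.rep fun self exit =>
    .pop (fReg .inp) (fun v o => (o, v.2)) <|
      .branch (fun v => v.1.isSome)
        (.branch (fun v => (v.1.getD default).isLeft)
          (.push (fReg .acc) (fun v => (v.1.getD default).getLeft?.getD default) <|
            .goto fun _ => self)
          (.push (fReg .mid) (fun v => (v.1.getD default).getRight?.getD default) <|
            .goto fun _ => self))
        (.goto fun _ => exit)

theorem splitFrag_runs (x : List (B ⊕ Option A)) (F : Unit → ∀ k, List (M.Γ k))
    (w : Unit → M.σ) (o : Option (B ⊕ Option A)) (b : List B) (m : List (Option A)) :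
    (splitFrag A B M).Runs (o, w) (stk (fregs x [] [] b m []) F) (none, w)
      (stk (fregs [] [] [] ((x.filterMap Sum.getLeft?).reverse ++ b)
        ((x.filterMap Sum.getRight?).reverse ++ m) []) F) (x.length + 1) := by
  induction x generalizing o b m with
  | nil => exact Frag.rep_exit fun self exit => by simp
  | cons a x ih =>
    rcases a with a | a
    · refine Frag.rep_next (v₁ := (some (.inl a), w)) (S₁ := stk (fregs x [] [] (a :: b) m []) F)
        (fun self exit => by simp) ?_
      exact (ih (some (.inl a)) (a :: b) m).congr_stk (by simp [List.filterMap_cons])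
    · refine Frag.rep_next (v₁ := (some (.inr a), w)) (S₁ := stk (fregs x [] [] b (a :: m) []) F)
        (fun self exit => by simp) ?_
      exact (ih (some (.inr a)) b (a :: m)).congr_stk (by simp [List.filterMap_cons])

end

/-- Move the first list element to the stack `elt`. -/
def nextFrag (A B : Type) [Inhabited A] (M : FinTM2) : Frag (FoldAllΓ A B M) (Foldσ A B M) :=
  Frag.rep fun self exit =>
    .pop (fReg .lst) (fun v o => (o.map .inr, v.2)) <|
      .branch (fun v => (listSym v.1).isSome)
        (.push (fReg .elt) (fun v => (listSym v.1).getD default) <| .goto fun _ => self)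
        (.goto fun _ => exit)

theorem nextFrag_runs (a : List A) (l : List (Option A)) (F : Unit → ∀ k, List (M.Γ k))
    (w : Unit → M.σ) (o : Option (B ⊕ Option A)) (e : List A) (b : List B) :
    (nextFrag A B M).Runs (o, w) (stk (fregs [] (a.map some ++ none :: l) e b [] []) F)
      (some (.inr none), w) (stk (fregs [] l (a.reverse ++ e) b [] []) F) (a.length + 1) := by
  induction a generalizing o e with
  | nil => exact Frag.rep_exit fun self exit => by simp
  | cons a x ih =>
    refine Frag.rep_next (v₁ := (some (.inr (some a)), w))
      (S₁ := stk (fregs [] (x.map some ++ none :: l) (a :: e) b [] []) F)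
      (fun self exit => by simp) ?_
    exact (ih (some (.inr (some a))) (a :: e)).congr_stk (by simp)

variable [Inhabited B]

/-- One round of the fold. -/
def foldBody (M : FinTM2) (i : B ⊕ A → M.Γ M.k₀) (o : M.Γ M.k₁ → B) :
    Frag (FoldAllΓ A B M) (Foldσ A B M) :=
  (nextFrag A B M).seq <|
  (Frag.move (fReg .elt) (fMach M.k₀) (fun a => .inr (some a))
    (fun s => i (.inr ((listSym (some s)).getD default)))).seq <|
  (Frag.move (fReg .acc) (fMach M.k₀) .inl (fun s => i (.inl (s.getLeft?.getD default)))).seq <|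
  (call _ (fun _ : Unit => M) ()).seq <|
  Frag.move (fMach M.k₁) (fReg .acc) (fun x => .inl (o x)) (fun s => s.getLeft?.getD default)

/-- The rounds of the fold. -/
def foldLoop (M : FinTM2) (i : B ⊕ A → M.Γ M.k₀) (o : M.Γ M.k₁ → B) :
    Frag (FoldAllΓ A B M) (Foldσ A B M) :=
  Frag.whilePeek (fReg .lst) (fun v o => (o.map .inr, v.2)) (fun v => v.1.isSome) (foldBody M i o)

/-- The program that folds the function computed by `M` over a list. -/
def foldFrag (M : FinTM2) (i : B ⊕ A → M.Γ M.k₀) (o : M.Γ M.k₁ → B) :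
    Frag (FoldAllΓ A B M) (Foldσ A B M) :=
  (splitFrag A B M).seq <|
  (Frag.move (fReg .mid) (fReg .lst) .inr (fun s => s.getRight?.getD default)).seq <|
  (foldLoop M i o).seq <|
  Frag.move (fReg .acc) (fReg .out) .inl (fun s => s.getLeft?.getD default)

theorem foldBody_runs {i : B ⊕ A → M.Γ M.k₀} {o : M.Γ M.k₁ → B} {a : List A} {b b' : List B}
    {l : List (Option A)} {y : List (M.Γ M.k₁)} {t : ℕ} (s : Option (B ⊕ Option A))
    (h : Outputs M ((b.map Sum.inl ++ a.map Sum.inr).map i) y t) (hy : y.map o = b') :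
    (foldBody M i o).Runs (s, fun _ => M.initialState)
      (stk (fregs [] (a.map some ++ none :: l) [] b.reverse [] []) fun _ => noStk M)
      (none, fun _ => M.initialState) (stk (fregs [] l [] b'.reverse [] []) fun _ => noStk M)
      ((a.length + 1) + ((a.length + 1) + ((b.length + 1) + (t + (b'.length + 1))))) := by
  subst hy
  unfold foldBody
  refine Frag.Runs.seq (nextFrag_runs a l (fun _ => noStk M) _ _ [] b.reverse) <|
    Frag.Runs.seq ((Frag.move_runs (k := fReg .elt) (k' := fMach M.k₀) (x := a.reverse) (by simp)
      (by simp) (S' := stk (fregs [] l [] b.reverse [] [])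
        fun _ => Function.update (noStk M) M.k₀ ((a.map Sum.inr).map i)) ?_).mono (by simp)) <|
    Frag.Runs.seq ((Frag.move_runs (k := fReg .acc) (k' := fMach M.k₀) (x := b.reverse) (by simp)
      (by simp) (S' := stk (fregs [] l [] [] [] [])
        fun _ => Function.update (noStk M) M.k₀ ((b.map Sum.inl ++ a.map Sum.inr).map i)) ?_).mono
          (by simp)) <|
    Frag.Runs.seq (v₁ := (none, fun _ => M.initialState))
      (S₁ := stk (fregs [] l [] [] [] []) fun _ => Function.update (noStk M) M.k₁ y) ?_ <|
    (Frag.move_runs (k := fMach M.k₁) (k' := fReg .acc) (x := y) (by simp)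
      (by simp) ?_).mono (by simp)
  · simp [Function.comp_def]
  · simp [Function.comp_def]
  · exact (call_runs (M := fun _ : Unit => M) () h rfl rfl).congr_stk (by simp)
  · simp

/-- The encoding of `c` by the code of `g c`. -/
@[reducible] def pullEnc {γ δ : Type} [Enc δ] (g : γ → δ) : Enc γ :=
  ⟨Enc.Γ δ, inferInstance, inferInstance, fun c => enc (g c)⟩

variable {α β : Type} [Enc α] [Enc β]

theorem foldLoop_runs {M : FinTM2} {i : Enc.Γ β ⊕ Enc.Γ α → M.Γ M.k₀} {o : M.Γ M.k₁ → Enc.Γ β}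
    {step : β × α → β} {p : Polynomial ℕ}
    (hM : ∀ x, ∃ y, y.map o = enc (step x) ∧ Outputs M ((enc x).map i) y (p.eval (size x)))
    {N : ℕ} (l : List α) (b : β)
    (hN : ∀ l', l' <+: l → size (l'.foldl (fun b a => step (b, a)) b) ≤ N)
    (hl : ∀ a ∈ l, size a ≤ N) (s : Option (Enc.Γ β ⊕ Option (Enc.Γ α))) :
    (foldLoop M i o).Runs (s, fun _ => M.initialState)
      (stk (fregs [] (enc l) [] (enc b).reverse [] []) fun _ => noStk M)
      (none, fun _ => M.initialState)
      (stk (fregs [] [] [] (enc (l.foldl (fun b a => step (b, a)) b)).reverse [] [])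
        fun _ => noStk M)
      (l.length * (p.eval (N + N) + 4 * N + 5) + 1) := by
  induction l generalizing b s with
  | nil =>
    refine Frag.Runs.mono (Frag.whilePeek_exit ?_) (by simp)
    simp
  | cons a l ih =>
    obtain ⟨y, hy, hO⟩ := hM (b, a)
    have h₁ : size a ≤ N := hl a (by simp)
    have h₂ : size b ≤ N := hN [] (by simp)
    have h₃ : size (step (b, a)) ≤ N := hN [a] (by simp)
    have h₄ : p.eval (size (b, a)) ≤ p.eval (N + N) := eval_mono p (by simp; omega)
    have hne : (enc (a :: l)).head?.isSome = true := by
      rw [enc_cons]; cases (enc a) <;> simp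
    have body := foldBody_runs (l := enc l) ((enc (a :: l)).head?.map .inr) hO hy
    rw [← enc_cons] at body
    refine (Frag.whilePeek_next (by simpa using hne) body
      (ih (step (b, a)) (fun l' hl' => hN (a :: l') (by simpa using hl'))
        (fun a ha => hl a (by simp [ha])) _)).mono ?_
    simp only [size, List.length_cons, Nat.add_one_mul] at *
    omega

theorem Frag.Runs.congr_init {K : Type} [DecidableEq K] {Γ : K → Type} {σ : Type} {c : Frag Γ σ}
    {v v' : σ} {S S' T T' : ∀ k, List (Γ k)} {t : ℕ} (h : c.Runs v S v' S' t) (e : S = T)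
    (e' : S' = T') : c.Runs v T v' T' t := e ▸ e' ▸ h

/-- If `step` is computable in polynomial time and the intermediate values have polynomially
bounded size, then folding `step` over a list is computable in polynomial time. -/
theorem Poly.foldl_of_pair {γ : Type} [Enc γ] {step : β × α → β} (hs : Poly step)
    {g : γ → β × List α} (hg : Poly g) (q : Polynomial ℕ)
    (hq : ∀ c l', l' <+: (g c).2 →
      size (l'.foldl (fun b a => step (b, a)) (g c).1) ≤ q.eval (size (g c))) :
    Poly fun c => (g c).2.foldl (fun b a => step (b, a)) (g c).1 := by
  obtain ⟨M, i, o, p, hM⟩ := hs.elim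
  -- The fold machine works on the encodings of the values of `g`.
  have hg' : @Poly γ γ _ (pullEnc g) id :=
    computable_congr (f := g) (ea := enc) (eb := enc) hg id (fun _ => rfl) (fun _ => rfl)
  refine @Poly.comp γ γ β _ (pullEnc g) _
    (fun c => (g c).2.foldl (fun b a => step (b, a)) (g c).1) id ?_ hg'
  let S : Polynomial ℕ := .X + q
  refine @Poly.of_runs γ β (pullEnc g) _ (FoldK M) _ _ (FoldAllΓ (Enc.Γ α) (Enc.Γ β) M) _ _
    (fReg .inp) (fReg .out) (Equiv.refl _) (Equiv.refl _) (none, fun _ => M.initialState)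
    (foldFrag M i o) _
    ((.X + 1) + ((.X + 1) + ((.X * (p.comp (S + S) + 4 * S + 5) + 1) + (q + 1)))) fun c => ?_
  erw [List.map_id, List.map_id]
  have e₁ : Function.update (β := fun k => List (FoldAllΓ (Enc.Γ α) (Enc.Γ β) M k))
      (fun _ => []) (fReg .inp) (enc (g c)) =
      stk (fregs (enc (g c)) [] [] [] [] []) fun _ => noStk M := by
    funext k
    rcases k with (_ | _ | _ | _ | _ | _) | ⟨_, k⟩ <;> simp
  have e₂ : ∀ x : List (Enc.Γ β),
      Function.update (β := fun k => List (FoldAllΓ (Enc.Γ α) (Enc.Γ β) M k))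
      (fun _ => []) (fReg .out) x =
      stk (fregs [] [] [] [] [] x) fun _ => noStk M := by
    intro x
    funext k
    rcases k with (_ | _ | _ | _ | _ | _) | ⟨_, k⟩ <;> simp
  refine Frag.Runs.congr_init ?_ e₁.symm (e₂ _).symm
  have hf₁ : (enc (g c)).filterMap Sum.getLeft? = enc (g c).1 := by
    simp [enc_prod, List.filterMap_map, Function.comp_def]
  have hf₂ : (enc (g c)).filterMap Sum.getRight? = enc (g c).2 := by
    simp [enc_prod, List.filterMap_map, Function.comp_def]
  have hsz := size_prod (g c)
  have hlen := length_le_size (g c).2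
  have hfin := hq c (g c).2 List.prefix_rfl
  set N := size (g c) + q.eval (size (g c)) with hNdef
  have loop := foldLoop_runs (o := o) hM (N := N) (g c).2 (g c).1
    (fun l' hl' => (hq c l' hl').trans (by omega))
    (fun a ha => (size_le_of_mem ha).trans (by omega)) none
  refine (Frag.Runs.seq (splitFrag_runs _ _ _ _ [] []) <|
    Frag.Runs.seq (Frag.move_runs (k := fReg .mid) (k' := fReg .lst) (x := (enc (g c).2).reverse)
      (by simp) (by simp [hf₂])
      (S' := stk (fregs [] (enc (g c).2) [] (enc (g c).1).reverse [] []) fun _ => noStk M) ?_) <|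
    Frag.Runs.seq loop (Frag.move_runs (k := fReg .acc) (k' := fReg .out) (by simp) rfl ?_)).mono ?_
  · simp [hf₁]
  · simp
  · have : (g c).2.length * (p.eval (N + N) + 4 * N + 5) ≤
        size (g c) * (p.eval (N + N) + 4 * N + 5) := Nat.mul_le_mul_right _ (by omega)
    have hS : S.eval (size (g c)) = N := by simp [S, hNdef]
    change _ ≤ Polynomial.eval (size (g c)) _
    simp only [Polynomial.eval_add, Polynomial.eval_mul, Polynomial.eval_X, Polynomial.eval_ofNat,
      Polynomial.eval_comp, Polynomial.eval_one, hS]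
    simp only [size, List.length_reverse, stk_inl, fregs_acc] at *
    omega

end Fold

/-! ### Basic polynomial-time functions -/

section Closure

variable {α β γ δ : Type} [Enc α] [Enc β] [Enc γ] [Enc δ]

theorem transduce_append {Q A B : Type} (step : Q → A → Q × List B) (flush : Q → List B) (q : Q)
    (l l' : List A) : transduce step flush q (l ++ l') =
      transduce step (fun _ => []) q l ++
        transduce step flush (l.foldl (fun q a => (step q a).1) q) l' := by
  induction l generalizing q with
  | nil => simp [transduce]
  | cons a l ih => simp [transduce, ih]

theorem transduce_map {Q A A' B : Type} (step : Q → A → Q × List B) (flush : Q → List B) (q : Q)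
    (f : A' → A) (l : List A') : transduce step flush q (l.map f) =
      transduce (fun q a => step q (f a)) flush q l := by
  induction l generalizing q with
  | nil => rfl
  | cons a l ih => simp [transduce, ih]

/-- The output of a transducer that stays in the state `q`. -/
theorem transduce_const {Q A B : Type} {step : Q → A → Q × List B} {flush : Q → List B} {q : Q}
    {e : A → List B} (l : List A) (h : ∀ a ∈ l, step q a = (q, e a)) :
    transduce step flush q l = l.flatMap e ++ flush q := by
  induction l with
  | nil => rfl
  | cons a l ih =>
    simp [transduce, h a (by simp), ih fun b hb => h b (by simp [hb])]

theorem foldl_const_of {Q A : Type} {f : Q → A → Q} {q : Q} (l : List A) (h : ∀ a, f q a = q) :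
    l.foldl f q = q := by
  induction l with
  | nil => rfl
  | cons a l ih => simp [h, ih]

/-- A function that replaces every symbol of the code by a string and appends a string. -/
theorem Poly.of_flatMap {f : α → β} (e : Enc.Γ α → List (Enc.Γ β)) (s : List (Enc.Γ β))
    (h : ∀ a, (enc a).flatMap e ++ s = enc (f a)) : Poly f :=
  Poly.of_transduce () (fun _ a => ((), e a)) (fun _ => s) fun a => by
    rw [← h, transduce_const]
    exact fun _ _ => rfl

theorem Poly.id : Poly fun a : α => a :=
  .of_flatMap (fun x => [x]) [] fun a => by simp

theorem Poly.const (b : β) : Poly fun _ : α => b :=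
  .of_flatMap (fun _ => []) (enc b) fun a => by simp

theorem Poly.fst' : Poly fun x : α × β => x.1 :=
  .of_flatMap (fun x => x.elim (fun a => [a]) fun _ => []) [] fun a => by
    simp [enc_prod, List.flatMap_map]

theorem Poly.snd' : Poly fun x : α × β => x.2 :=
  .of_flatMap (fun x => x.elim (fun _ => []) fun a => [a]) [] fun a => by
    simp [enc_prod, List.flatMap_map]

theorem Poly.fst {f : γ → α × β} (hf : Poly f) : Poly fun c => (f c).1 := Poly.fst'.comp hf

theorem Poly.snd {f : γ → α × β} (hf : Poly f) : Poly fun c => (f c).2 := Poly.snd'.comp hf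

theorem Poly.singleton {f : γ → α} (hf : Poly f) : Poly fun c => [f c] := by
  refine Poly.comp (g := fun a : α => [a]) (.of_flatMap (fun x => [some x]) [none] fun a => ?_) hf
  simp only [enc_cons, enc_nil]
  rw [List.map_eq_flatMap]

theorem Poly.append {f g : γ → List α} (hf : Poly f) (hg : Poly g) :
    Poly fun c => f c ++ g c := by
  refine Poly.comp (g := fun x : List α × List α => x.1 ++ x.2)
    (.of_flatMap (fun x => x.elim (fun a => [a]) fun a => [a]) [] fun a => ?_) (hf.pair hg)
  simp [enc_prod, List.flatMap_map, enc_append]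

theorem Poly.flatten {f : γ → List (List α)} (hf : Poly f) : Poly fun c => (f c).flatten := by
  refine Poly.comp (g := fun x : List (List α) => x.flatten)
    (.of_flatMap (fun x => x.toList) [] fun l => ?_) hf
  rw [List.append_nil]
  induction l with
  | nil => rfl
  | cons a l ih =>
    rw [enc_cons, List.flatten_cons, enc_append, ← ih]
    simp [List.flatMap_map]

/-- The code of a triple `(b, x, y)` begins with the bit `b`. A transducer keeps it in its state and
copies `x` or `y` accordingly. -/
theorem Poly.cond {b : γ → Bool} {f g : γ → α} (hb : Poly b) (hf : Poly f) (hg : Poly g) :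
    Poly fun c => bif b c then f c else g c := by
  refine Poly.comp (g := fun x : Bool × α × α => bif x.1 then x.2.1 else x.2.2)
    (.of_transduce false (fun (q : Bool) (x : Bool ⊕ (Enc.Γ α ⊕ Enc.Γ α)) =>
      x.elim (fun b => (b, [])) (Sum.elim (fun a => (q, bif q then [a] else []))
        fun a => (q, bif q then [] else [a]))) (fun _ => []) fun x => ?_) (hb.pair (hf.pair hg))
  obtain ⟨b, x, y⟩ := x
  have h : (enc (b, x, y) : List (Bool ⊕ (Enc.Γ α ⊕ Enc.Γ α))) =
      .inl b :: ((enc x).map fun a => .inr (.inl a)) ++ (enc y).map fun a => .inr (.inr a) := by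
    simp [enc_prod, enc_bool, Function.comp_def]
  rw [h, List.cons_append, transduce, transduce_append, transduce_map, transduce_map]
  simp only [Sum.elim_inl, Sum.elim_inr]
  rw [transduce_const (e := fun a => bif b then [a] else []) _ (fun _ _ => rfl), List.foldl_map,
    foldl_const_of _ (fun _ => rfl),
    transduce_const (e := fun a => bif b then [] else [a]) _ (fun _ _ => rfl)]
  cases b <;> simp

theorem Poly.any_id {f : γ → List Bool} (hf : Poly f) : Poly fun c => (f c).any fun b => b := by
  refine Poly.comp (g := fun l : List Bool => l.any fun b => b)
    (.of_transduce false (fun (q : Bool) (x : Option Bool) => (q || x.getD false, []))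
      (fun q => [q]) fun l => ?_) hf
  have : ∀ (q : Bool) (l : List Bool), transduce
      (fun (q : Bool) (x : Option Bool) => (q || x.getD false, ([] : List Bool)))
      (fun q => [q]) q (enc l) = [q || l.any fun b => b] := by
    intro q l
    induction l generalizing q with
    | nil => simp [transduce]
    | cons b l ih =>
      rw [enc_cons, enc_bool]
      simp only [List.map_cons, List.map_nil, List.cons_append, List.nil_append, transduce, ih]
      simp [Bool.or_assoc]
  rw [this, Bool.false_or]
  rfl

/-- The state of the transducer tells whether the separator after the first element has been
read. -/
theorem Poly.tail {f : γ → List α} (hf : Poly f) : Poly fun c => (f c).tail := by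
  refine Poly.comp (g := fun l : List α => l.tail)
    (.of_transduce false (fun (q : Bool) (x : Option (Enc.Γ α)) =>
      (q || x.isNone, bif q then [x] else [])) (fun _ => []) fun l => ?_) hf
  rcases l with _ | ⟨a, l⟩
  · rfl
  · rw [enc_cons, transduce_append, transduce_const (e := fun _ => []) _ (by simp),
      List.foldl_map, foldl_const_of _ (by simp), transduce,
      transduce_const (e := fun x => [x]) _ (by simp)]
    simp

theorem Poly.take_one {f : γ → List α} (hf : Poly f) : Poly fun c => (f c).take 1 := by
  refine Poly.comp (g := fun l : List α => l.take 1)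
    (.of_transduce false (fun (q : Bool) (x : Option (Enc.Γ α)) =>
      (q || x.isNone, bif q then [] else [x])) (fun _ => []) fun l => ?_) hf
  rcases l with _ | ⟨a, l⟩
  · rfl
  · rw [enc_cons, transduce_append, transduce_const (e := fun x => [x]) _ (by simp),
      List.foldl_map, foldl_const_of _ (by simp), transduce,
      transduce_const (e := fun x => []) _ (by simp)]
    simp [enc_cons]

theorem Poly.and {f g : γ → Bool} (hf : Poly f) (hg : Poly g) : Poly fun c => f c && g c :=
  (hf.cond hg (.const false)).comp .id |> fun h => by
    convert h using 2 with c; cases f c <;> rfl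

theorem Poly.or {f g : γ → Bool} (hf : Poly f) (hg : Poly g) : Poly fun c => f c || g c :=
  (hf.cond (.const true) hg).comp .id |> fun h => by
    convert h using 2 with c; cases f c <;> rfl

theorem Poly.not {f : γ → Bool} (hf : Poly f) : Poly fun c => !f c :=
  (hf.cond (.const false) (.const true)).comp .id |> fun h => by
    convert h using 2 with c; cases f c <;> rfl

/-! ### Recursion on lists -/

/-- Recursion on a list, with parameters. It suffices to bound the sizes of the values that occur,
that is, of the folds over the prefixes of the list. -/
theorem Poly.foldl {l : γ → List α} {init : γ → β} {step : γ → β → α → β} (hl : Poly l)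
    (hi : Poly init) (hs : Poly fun x : (γ × β) × α => step x.1.1 x.1.2 x.2) (q : Polynomial ℕ)
    (hq : ∀ c l', l' <+: l c → size (l'.foldl (step c) (init c)) ≤ q.eval (size c)) :
    Poly fun c => (l c).foldl (step c) (init c) := by
  have key : ∀ (c : γ) (b : β) (l : List α),
      l.foldl (fun (x : γ × β) a => (x.1, step x.1 x.2 a)) (c, b) = (c, l.foldl (step c) b) := by
    intro c b l
    induction l generalizing b with
    | nil => rfl
    | cons a l ih => simp [ih]
  have := (Poly.foldl_of_pair (step := fun x : (γ × β) × α => (x.1.1, step x.1.1 x.1.2 x.2))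
    (Poly.fst'.fst.pair hs) (g := fun c => ((c, init c), l c)) ((Poly.id.pair hi).pair hl) (.X + q)
    fun c l' hl' => ?_).snd
  · simpa only [key] using this
  · have h₁ := hq c l' hl'
    have h₂ : q.eval (size c) ≤ q.eval (size ((c, init c), l c)) := eval_mono q (by simp; omega)
    simp only [key, size_prod, Polynomial.eval_add, Polynomial.eval_X] at *
    omega

theorem foldl_append_eq_map {α β : Type*} (f : α → β) (l : List α) (s : List β) :
    l.foldl (fun s a => s ++ [f a]) s = s ++ l.map f := by
  induction l generalizing s with
  | nil => simp
  | cons a l ih => simp [ih]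

theorem size_map_le {α : Type*} {f : α → β} {N : ℕ} (l : List α) (h : ∀ a ∈ l, size (f a) ≤ N) :
    size (l.map f) ≤ l.length * (N + 1) := by
  induction l with
  | nil => simp
  | cons a l ih =>
    have h₁ := h a (by simp)
    have h₂ := ih fun b hb => h b (by simp [hb])
    rw [List.map_cons, size_cons, List.length_cons, Nat.add_one_mul]
    omega

theorem Poly.map {l : γ → List α} {f : γ → α → β} (hl : Poly l)
    (hf : Poly fun x : γ × α => f x.1 x.2) : Poly fun c => (l c).map (f c) := by
  obtain ⟨p, hp⟩ := hl.exists_size_le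
  obtain ⟨q, hq⟩ := hf.exists_size_le
  have := Poly.foldl (init := fun _ => []) (step := fun c s a => s ++ [f c a]) hl (.const [])
    (Poly.fst'.snd.append (hf.comp (Poly.fst'.fst.pair Poly.snd')).singleton)
    (p * (q.comp (.X + p) + 1)) fun c l' hl' => ?_
  · simpa only [foldl_append_eq_map, List.nil_append] using this
  · rw [foldl_append_eq_map, List.nil_append]
    refine (size_map_le (N := (q.comp (.X + p)).eval (size c)) _ fun a ha => ?_).trans ?_
    · refine (hq (c, a)).trans ?_
      rw [Polynomial.eval_comp]
      refine eval_mono q ?_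
      have h₁ := size_le_of_mem (hl'.subset ha)
      have h₂ := hp c
      simp
      omega
    · rw [Polynomial.eval_mul, Polynomial.eval_add, Polynomial.eval_one]
      refine Nat.mul_le_mul_right _ ?_
      exact hl'.length_le.trans ((length_le_size _).trans (hp c))

theorem Poly.flatMap {l : γ → List α} {f : γ → α → List β} (hl : Poly l)
    (hf : Poly fun x : γ × α => f x.1 x.2) : Poly fun c => (l c).flatMap (f c) :=
  (hl.map hf).flatten

theorem Poly.any {l : γ → List α} {f : γ → α → Bool} (hl : Poly l)
    (hf : Poly fun x : γ × α => f x.1 x.2) : Poly fun c => (l c).any (f c) := by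
  simpa [List.any_map, Function.comp_def] using (hl.map hf).any_id

theorem size_tail_le (l : List α) : size l.tail ≤ size l := by
  cases l <;> simp

theorem size_zip_le (l : List α) (l' : List β) : size (l.zip l') ≤ size l + size l' := by
  induction l generalizing l' with
  | nil => simp
  | cons a l ih =>
    rcases l' with _ | ⟨b, l'⟩
    · simp
    · have := ih l'
      simp only [List.zip_cons_cons, size_cons, size_prod]
      omega

theorem Poly.zip {f : γ → List α} {g : γ → List β} (hf : Poly f) (hg : Poly g) :
    Poly fun c => (f c).zip (g c) := by
  obtain ⟨p, hp⟩ := hf.exists_size_le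
  obtain ⟨q, hq⟩ := hg.exists_size_le
  have key : ∀ (l : List α) (l' : List β) (s : List (α × β)),
      l.foldl (fun (x : List β × List (α × β)) a =>
        (x.1.tail, x.2 ++ (x.1.take 1).map fun b => (a, b))) (l', s) =
        (l'.drop l.length, s ++ l.zip l') := by
    intro l
    induction l with
    | nil => simp
    | cons a l ih =>
      intro l' s
      rw [List.foldl_cons, ih]
      cases l' <;> simp
  have := (Poly.foldl (init := fun c => (g c, ([] : List (α × β))))
    (step := fun _ (x : List β × List (α × β)) a =>
        (x.1.tail, x.2 ++ (x.1.take 1).map fun b => (a, b))) hf (hg.pair (.const []))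
    (Poly.fst'.snd.fst.tail.pair (Poly.fst'.snd.snd.append
      (Poly.map (f := fun x b => (x.2, b)) Poly.fst'.snd.fst.take_one
        (Poly.fst'.snd.pair .snd'))))
    (p + q + q) fun c l' hl' => ?_).snd
  · simpa only [key, List.nil_append] using this
  · rw [key, size_prod]
    have h₁ : ∀ (n : ℕ) (l : List β), size (l.drop n) ≤ size l := by
      intro n
      induction n with
      | zero => simp
      | succ n ih => intro l; rw [← List.tail_drop]; exact (size_tail_le _).trans (ih l)
    have h₁ := h₁ l'.length (g c)
    have h₂ := size_zip_le l' (g c)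
    obtain ⟨t, ht⟩ := hl'
    have h₃ : size l' + size t = size (f c) := by rw [← ht, size_append]
    have := hp c
    have := hq c
    simp only [Polynomial.eval_add, List.nil_append]
    omega

end Closure

/-! ### Operations on adjacency tables -/

/-- A row of a table: the adjacencies of a vertex, and its weight in binary. -/
abbrev Row : Type := List Bool × List Bool

section Table

variable {α γ : Type} [Enc α] [Enc γ]

/-- The entries of `l` at the positions that are marked in `m`. -/
def maskFilter {α : Type*} (m : List Bool) (l : List α) : List α :=
  (m.zip l).flatMap fun x => bif x.1 then [x.2] else []

theorem Poly.maskFilter {m : γ → List Bool} {l : γ → List α} (hm : Poly m) (hl : Poly l) :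
    Poly fun c => maskFilter (m c) (l c) :=
  (hm.zip hl).flatMap (f := fun _ (x : Bool × α) => bif x.1 then [x.2] else [])
    (Poly.snd'.fst.cond Poly.snd'.snd.singleton (.const []))

/-- The table of the subgraph induced by the marked vertices. -/
def subTable (m : List Bool) (I : List Row) : List Row :=
  maskFilter m (I.map fun r => (maskFilter m r.1, r.2))

theorem Poly.subTable {m : γ → List Bool} {I : γ → List Row} (hm : Poly m) (hI : Poly I) :
    Poly fun c => subTable (m c) (I c) :=
  hm.maskFilter (hI.map (f := fun c (r : Row) => (PolyTime.maskFilter (m c) r.1, r.2))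
    (((hm.comp .fst').maskFilter Poly.snd'.fst).pair Poly.snd'.snd))

/-- Is some position marked in both masks? -/
def meets (p q : List Bool) : Bool := (p.zip q).any fun x => x.1 && x.2

theorem Poly.meets {p q : γ → List Bool} (hp : Poly p) (hq : Poly q) :
    Poly fun c => meets (p c) (q c) :=
  (hp.zip hq).any (f := fun _ (x : Bool × Bool) => x.1 && x.2) (Poly.snd'.fst.and Poly.snd'.snd)

/-- Is some position marked in `q` but not in `p`? -/
def misses (p q : List Bool) : Bool := (p.zip q).any fun x => !x.1 && x.2

theorem Poly.misses {p q : γ → List Bool} (hp : Poly p) (hq : Poly q) :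
    Poly fun c => misses (p c) (q c) :=
  (hp.zip hq).any (f := fun _ (x : Bool × Bool) => !x.1 && x.2)
    (Poly.snd'.fst.not.and Poly.snd'.snd)

/-- Mark also the vertices that distinguish between marked vertices: those that are adjacent to some
marked vertex, but not to all. -/
def closeStep (I : List Row) (p : List Bool) : List Bool :=
  (I.zip p).map fun x => x.2 || (meets x.1.1 p && misses x.1.1 p)

theorem Poly.closeStep {I : γ → List Row} {p : γ → List Bool} (hI : Poly I) (hp : Poly p) :
    Poly fun c => closeStep (I c) (p c) :=
  (hI.zip hp).map (f := fun c (x : Row × Bool) =>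
    x.2 || (PolyTime.meets x.1.1 (p c) && PolyTime.misses x.1.1 (p c)))
    (Poly.snd'.snd.or ((Poly.snd'.fst.fst.meets (hp.comp .fst')).and
      (Poly.snd'.fst.fst.misses (hp.comp .fst'))))

theorem size_listBool (l : List Bool) : size l = 2 * l.length := by
  induction l with
  | nil => rfl
  | cons b l ih => rw [size_cons, ih, size_bool, List.length_cons]; omega

theorem size_closeStep_le (I : List Row) (p : List Bool) : size (closeStep I p) ≤ size p := by
  rw [size_listBool, size_listBool]
  simp [closeStep]

/-- The mask of the least module that contains the marked vertices. As many rounds as there are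
vertices suffice. -/
def closeTable (I : List Row) (p : List Bool) : List Bool :=
  I.foldl (fun p _ => closeStep I p) p

theorem Poly.closeTable {I : γ → List Row} {p : γ → List Bool} (hI : Poly I) (hp : Poly p) :
    Poly fun c => closeTable (I c) (p c) := by
  obtain ⟨q, hq⟩ := hp.exists_size_le
  refine Poly.foldl (step := fun c p _ => PolyTime.closeStep (I c) p) hI hp
    ((hI.comp Poly.fst'.fst).closeStep Poly.fst'.snd) q fun c l' hl' => ?_
  clear hl'
  refine le_trans ?_ (hq c)
  generalize p c = s
  induction l' generalizing s with
  | nil => exact le_rfl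
  | cons a l ih => exact (ih (PolyTime.closeStep (I c) s)).trans (size_closeStep_le _ _)

/-- The masks with one mark, for the vertices of a table. Each vertex extends the masks of its
predecessors by an unmarked position and adds a mask of its own. -/
def unitMasks {α : Type*} (l : List α) : List (List Bool) :=
  l.foldl (fun U _ => (U.map fun u => u ++ [false]) ++ [(U.map fun _ => false) ++ [true]]) []

theorem unitMasks_eq {α : Type*} (l : List α) {n : ℕ} (hn : l.length = n) :
    unitMasks l = (List.finRange n).map fun u => (List.finRange n).map fun x => decide (x = u) := by
  induction l using List.reverseRecOn generalizing n with
  | nil => subst hn; rfl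
  | append_singleton l a ih =>
    rw [List.length_append, List.length_singleton] at hn
    subst hn
    rw [unitMasks, List.foldl_append]
    change (List.map _ (unitMasks l)) ++ [(List.map _ (unitMasks l)) ++ [true]] = _
    rw [ih rfl, List.finRange_succ_last]
    simp [Function.comp_def, Fin.ext_iff, (Fin.is_lt _).ne,
      (Fin.is_lt _).ne']

theorem Poly.unitMasks {l : γ → List α} (hl : Poly l) : Poly fun c => unitMasks (l c) := by
  obtain ⟨p, hp⟩ := hl.exists_size_le
  refine Poly.foldl (init := fun _ => ([] : List (List Bool))) (step := fun _ U _ =>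
    (U.map fun u => u ++ [false]) ++ [(U.map fun _ => false) ++ [true]]) hl (.const [])
    ((Poly.fst'.snd.map (f := fun _ (u : List Bool) => u ++ [false])
      (Poly.snd'.append (.const [false]))).append
      ((Poly.fst'.snd.map (f := fun _ (_ : List Bool) => false)
        (.const false)).append (.const [true])).singleton)
    (p * (2 * p + 1)) fun c l' hl' => ?_
  have h : l'.length ≤ p.eval (size c) :=
    hl'.length_le.trans ((length_le_size _).trans (hp c))
  have := unitMasks_eq l' rfl
  rw [PolyTime.unitMasks] at this
  rw [this]
  refine (size_map_le (N := 2 * l'.length) _ fun u _ => ?_).trans ?_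
  · simp [size_listBool]
  · rw [List.length_finRange]
    simp only [Polynomial.eval_mul, Polynomial.eval_add, Polynomial.eval_one,
      Polynomial.eval_ofNat]
    gcongr

/-- The masks with two marks, for the vertices of a table. -/
def pairMasks (U : List (List Bool)) : List (List Bool) :=
  U.flatMap fun u => U.flatMap fun v =>
    bif meets u v then [] else [(u.zip v).map fun x => x.1 || x.2]

theorem Poly.pairMasks {U : γ → List (List Bool)} (hU : Poly U) :
    Poly fun c => pairMasks (U c) :=
  hU.flatMap (f := fun c (u : List Bool) => (U c).flatMap fun v =>
      bif PolyTime.meets u v then [] else [(u.zip v).map fun x : Bool × Bool => x.1 || x.2])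
    ((hU.comp .fst').flatMap (f := fun (c : γ × List Bool) (v : List Bool) =>
        bif PolyTime.meets c.2 v then [] else [(c.2.zip v).map fun x : Bool × Bool => x.1 || x.2])
      ((Poly.fst'.snd.meets .snd').cond (.const [])
        ((Poly.fst'.snd.zip .snd').map (f := fun _ (x : Bool × Bool) => x.1 || x.2)
          (Poly.snd'.fst.or Poly.snd'.snd)).singleton))

theorem size_foldl_le_of_choice {β : Type} [Enc β] {f : β → β → β}
    (hf : ∀ a b, f a b = a ∨ f a b = b) (l : List β) (b : β) :
    size (l.foldl f b) ≤ size b + size l := by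
  induction l generalizing b with
  | nil => simp
  | cons a l ih =>
    have := ih (f b a)
    rw [List.foldl_cons, size_cons]
    rcases hf b a with h | h <;> rw [h] at this ⊢ <;> omega

theorem size_le_of_prefix {l l' : List α} (h : l' <+: l) : size l' ≤ size l := by
  obtain ⟨t, rfl⟩ := h
  simp

/-- Folding a function that keeps one of its two arguments. -/
theorem Poly.foldl_choice {l : γ → List α} {init : γ → α} {step : γ → α → α → α} (hl : Poly l)
    (hi : Poly init) (hs : Poly fun x : (γ × α) × α => step x.1.1 x.1.2 x.2)
    (hc : ∀ c a b, step c a b = a ∨ step c a b = b) :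
    Poly fun c => (l c).foldl (step c) (init c) := by
  obtain ⟨p, hp⟩ := hl.exists_size_le
  obtain ⟨q, hq⟩ := hi.exists_size_le
  refine Poly.foldl hl hi hs (q + p) fun c l' hl' => ?_
  refine (size_foldl_le_of_choice (hc c) _ _).trans ?_
  rw [Polynomial.eval_add]
  exact Nat.add_le_add (hq c) ((size_le_of_prefix hl').trans (hp c))

/-- Runs through the list `l` and keeps the current mask, at first `m`, unless the next one is
contained in it. The result is contained in every mask of `l` that it contains. -/
def leastMask (m : List Bool) (l : List (List Bool)) : List Bool :=
  l.foldl (fun m c => bif misses m c then m else c) m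

theorem Poly.leastMask {m : γ → List Bool} {l : γ → List (List Bool)} (hm : Poly m)
    (hl : Poly l) : Poly fun c => leastMask (m c) (l c) :=
  Poly.foldl_choice (step := fun _ m c => bif PolyTime.misses m c then m else c) hl hm
    ((Poly.fst'.snd.misses .snd').cond Poly.fst'.snd .snd')
    fun _ a b => by cases PolyTime.misses a b <;> simp

/-- The mask of a minimal module with at least two vertices, if there are two vertices. It is
found among the least modules that contain a given pair of vertices. -/
def moduleMask (I : List Row) : List Bool :=
  leastMask (I.map fun _ => true) ((pairMasks (unitMasks I)).map (closeTable I))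

theorem Poly.moduleMask {I : γ → List Row} (hI : Poly I) : Poly fun c => moduleMask (I c) :=
  (hI.map (f := fun _ (_ : Row) => true) (.const true)).leastMask
    (hI.unitMasks.pairMasks.map ((hI.comp .fst').closeTable .snd'))

/-- A mask with one mark, at a position that is marked in `m`, if there is one. -/
def repMask (U : List (List Bool)) (m : List Bool) : List Bool :=
  U.foldl (fun r u => bif meets u m then u else r) (m.map fun _ => false)

theorem Poly.repMask {U : γ → List (List Bool)} {m : γ → List Bool} (hU : Poly U) (hm : Poly m) :
    Poly fun c => repMask (U c) (m c) :=
  Poly.foldl_choice (step := fun c r u => bif PolyTime.meets u (m c) then u else r) hU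
    (hm.map (f := fun _ (_ : Bool) => false) (.const false))
    ((Poly.snd'.meets (hm.comp Poly.fst'.fst)).cond .snd' Poly.fst'.snd)
    fun c a b => by cases PolyTime.meets b (m c) <;> simp

/-- The table in which the marked vertices are replaced by one of them, which gets the weight
`k`. -/
def contractTable (I : List Row) (m k : List Bool) : List Row :=
  subTable ((m.zip (repMask (unitMasks I) m)).map fun x => !x.1 || x.2)
    ((I.zip m).map fun x => (x.1.1, bif x.2 then k else x.1.2))

theorem Poly.contractTable {I : γ → List Row} {m k : γ → List Bool} (hI : Poly I) (hm : Poly m)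
    (hk : Poly k) : Poly fun c => contractTable (I c) (m c) (k c) :=
  ((hm.zip (hI.unitMasks.repMask hm)).map (f := fun _ (x : Bool × Bool) => !x.1 || x.2)
    (Poly.snd'.fst.not.or Poly.snd'.snd)).subTable
    ((hI.zip hm).map (f := fun c (x : Row × Bool) => (x.1.1, bif x.2 then k c else x.1.2))
      (Poly.snd'.fst.fst.pair (Poly.snd'.snd.cond (hk.comp .fst') Poly.snd'.fst.snd)))

end Table

end PolyTime

namespace GraphColoring

/-! ### Weighted colorings -/

section Coloring

variable {V W U : Type*}

theorem WeightedColorable.mono {G : SimpleGraph V} {w : V → ℕ} {k l : ℕ}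
    (h : WeightedColorable G w k) (hkl : k ≤ l) : WeightedColorable G w l := by
  obtain ⟨c, hc, hd⟩ := h
  exact ⟨fun v => (c v).map (Fin.castLEEmb hkl), fun v => by simp [hc], fun u v huv =>
    (Finset.disjoint_map _).2 (hd u v huv)⟩

theorem weightedChromaticNumber_le_iff [Finite V] {G : SimpleGraph V} {w : V → ℕ} {k : ℕ} :
    weightedChromaticNumber G w ≤ k ↔ WeightedColorable G w k := by
  have := Fintype.ofFinite V
  exact ⟨fun h => (weightedColorable_weightedChromaticNumber G w).mono h, fun h => Nat.sInf_le h⟩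

theorem weightedChromaticNumber_congr [Finite V] [Finite W] {G : SimpleGraph V} {w : V → ℕ}
    {H : SimpleGraph W} {w' : W → ℕ}
    (h : ∀ k, WeightedColorable G w k ↔ WeightedColorable H w' k) :
    weightedChromaticNumber G w = weightedChromaticNumber H w' :=
  le_antisymm (weightedChromaticNumber_le_iff.2 ((h _).2 (weightedChromaticNumber_le_iff.1 le_rfl)))
    (weightedChromaticNumber_le_iff.2 ((h _).1 (weightedChromaticNumber_le_iff.1 le_rfl)))

/-- The colors may be taken from any finite set. -/
theorem WeightedColorable.of_finset {C : Type*} {G : SimpleGraph V} {w : V → ℕ} (c : V → Finset C)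
    (hc : ∀ v, (c v).card = w v) (hd : ∀ u v, G.Adj u v → Disjoint (c u) (c v)) (S : Finset C)
    (hS : ∀ v, c v ⊆ S) : WeightedColorable G w S.card := by
  classical
  refine ⟨fun v => ((c v).subtype (· ∈ S)).map S.equivFin.toEmbedding, fun v => ?_,
    fun u v huv => (Finset.disjoint_map _).2 ?_⟩
  · rw [Finset.card_map, Finset.card_subtype, Finset.filter_true_of_mem fun x hx => hS v hx, hc]
  · rw [Finset.disjoint_left]
    intro x hx hx'
    exact Finset.disjoint_left.1 (hd u v huv) (Finset.mem_subtype.1 hx) (Finset.mem_subtype.1 hx')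

theorem weightedChromaticNumber_le_sum [Fintype V] (G : SimpleGraph V) (w : V → ℕ) :
    weightedChromaticNumber G w ≤ ∑ v, w v := by
  classical
  have := WeightedColorable.of_finset (G := G) (w := w) (C := Σ v, Fin (w v))
    (fun v => Finset.univ.map ⟨Sigma.mk v, sigma_mk_injective⟩) (fun v => by simp)
    (fun u v huv => ?_) Finset.univ (fun v => Finset.subset_univ _)
  · refine weightedChromaticNumber_le_iff.2 ?_
    simpa using this
  · rw [Finset.disjoint_left]
    intro x hx hx'
    simp only [Finset.mem_map, Finset.mem_univ, Function.Embedding.coeFn_mk, true_and] at hx hx'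
    obtain ⟨i, rfl⟩ := hx
    obtain ⟨j, hj⟩ := hx'
    exact huv.ne (congrArg Sigma.fst hj).symm

theorem weight_le_weightedChromaticNumber [Finite V] (G : SimpleGraph V) (w : V → ℕ) (v : V) :
    w v ≤ weightedChromaticNumber G w := by
  obtain ⟨c, hc, -⟩ := weightedChromaticNumber_le_iff.1 (le_refl (weightedChromaticNumber G w))
  exact hc v ▸ (Finset.card_le_univ (c v)).trans_eq (Fintype.card_fin _)

theorem weightedColorable_one_iff {G : SimpleGraph V} {k : ℕ} :
    WeightedColorable G (fun _ => 1) k ↔ G.Colorable k := by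
  constructor
  · rintro ⟨c, hc, hd⟩
    choose f hf using fun v => Finset.card_eq_one.1 (hc v)
    refine ⟨SimpleGraph.Coloring.mk f fun {u v} huv h => ?_⟩
    have := hd u v huv
    rw [hf, hf, Finset.disjoint_singleton] at this
    exact this h
  · rintro ⟨C⟩
    exact ⟨fun v => {C v}, fun v => Finset.card_singleton _, fun u v huv => by
      simpa using C.valid huv⟩

theorem weightedColorable_comap_iff {G : SimpleGraph V} {w : V → ℕ} {g : U → V}
    (hg : Function.Bijective g) {k : ℕ} :
    WeightedColorable (G.comap g) (fun u => w (g u)) k ↔ WeightedColorable G w k := by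
  constructor
  · rintro ⟨c, hc, hd⟩
    obtain ⟨f, -, hf⟩ := Function.bijective_iff_has_inverse.1 hg
    exact ⟨fun v => c (f v), fun v => (hc _).trans (congrArg w (hf v)), fun u v huv =>
      hd _ _ (by simpa [hf u, hf v] using huv)⟩
  · rintro ⟨c, hc, hd⟩
    exact ⟨fun u => c (g u), fun u => hc _, fun u v huv => hd _ _ huv⟩

/-- Contracting a module. If `r` is an element of the module `M`, then the weighted chromatic
number does not change when `M` is replaced by `r` with the weighted chromatic number of the
subgraph induced by `M` as its weight. Here `g` enumerates `M` and `f` the remaining vertices. -/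
theorem weightedChromaticNumber_contract [Finite V] [Finite U] [Finite W] {G : SimpleGraph V}
    {w : V → ℕ} {M : Set V} (hM : IsModule G M) {r : V} (hr : r ∈ M) {g : U → V}
    (hgM : Set.range g = M) {f : W → V}
    (hfr : ∀ v, v ∈ Set.range f ↔ (v ∉ M ∨ v = r)) {w' : W → ℕ}
    (hw : ∀ x, f x ∉ M → w' x = w (f x))
    (hw' : ∀ x, f x ∈ M → w' x = weightedChromaticNumber (G.comap g) fun u => w (g u)) :
    weightedChromaticNumber (G.comap f) w' = weightedChromaticNumber G w := by
  classical
  have adj_iff : ∀ x y, x ∉ M → y ∈ M → (G.Adj x y ↔ G.Adj x r) := by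
    intro x y hx hy
    rcases hM x hx with h | h
    · exact ⟨fun _ => h r hr, fun _ => h y hy⟩
    · exact ⟨fun h' => (h y hy h').elim, fun h' => (h r hr h').elim⟩
  have eq_r : ∀ x, f x ∈ M → f x = r := fun x hx =>
    ((hfr (f x)).1 ⟨x, rfl⟩).resolve_left (not_not.2 hx)
  have not_adj : ∀ x y, f x ∈ M → f y ∈ M → ¬ G.Adj (f x) (f y) := fun x y hx hy h =>
    h.ne ((eq_r x hx).trans (eq_r y hy).symm)
  refine weightedChromaticNumber_congr fun k => ⟨?_, ?_⟩
  · rintro ⟨c, hc, hd⟩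
    obtain ⟨x₀, hx₀⟩ : r ∈ Set.range f := (hfr r).2 (.inr rfl)
    have hx₀M : f x₀ ∈ M := hx₀ ▸ hr
    have := Fintype.ofFinite U
    obtain ⟨d, hdc, hdd⟩ := weightedColorable_weightedChromaticNumber (G.comap g) fun u => w (g u)
    have hcard : (c x₀).card = weightedChromaticNumber (G.comap g) fun u => w (g u) := by
      rw [hc, hw' x₀ hx₀M]
    let e := (c x₀).orderEmbOfFin hcard
    have : Nonempty U := by
      obtain ⟨u, -⟩ := (hgM ▸ hr : r ∈ Set.range g)
      exact ⟨u⟩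
    have : Nonempty W := ⟨x₀⟩
    choose! p hp using fun v (hv : v ∈ M) => (hgM ▸ hv : v ∈ Set.range g)
    choose! q hq using fun v (hv : v ∉ M) => (hfr v).2 (.inl hv)
    have he : ∀ s : Finset (Fin _), s.map e.toEmbedding ⊆ c x₀ := by
      intro s x hx
      obtain ⟨i, -, rfl⟩ := Finset.mem_map.1 hx
      exact Finset.orderEmbOfFin_mem _ hcard i
    have key : ∀ u v, u ∉ M → v ∈ M → G.Adj u v →
        Disjoint (c (q u)) ((d (p v)).map e.toEmbedding) := by
      intro u v hu hv huv
      refine Disjoint.mono_right (he _) (hd _ _ ?_)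
      rw [SimpleGraph.comap_adj, hq u hu, hx₀]
      exact (adj_iff u v hu hv).1 huv
    refine ⟨fun v => if v ∈ M then (d (p v)).map e.toEmbedding else c (q v), fun v => ?_,
      fun u v huv => ?_⟩
    · by_cases hv : v ∈ M
      · simp only [if_pos hv]
        rw [Finset.card_map, hdc]
        exact congrArg w (hp v hv)
      · simp only [if_neg hv]
        rw [hc, hw _ (by rw [hq v hv]; exact hv), hq v hv]
    · by_cases hu : u ∈ M <;> by_cases hv : v ∈ M
      · simp only [if_pos hu, if_pos hv]
        refine (Finset.disjoint_map _).2 (hdd _ _ ?_)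
        rw [SimpleGraph.comap_adj, hp u hu, hp v hv]
        exact huv
      · simp only [if_pos hu, if_neg hv]
        exact (key v u hv hu huv.symm).symm
      · simp only [if_neg hu, if_pos hv]
        exact key u v hu hv huv
      · simp only [if_neg hu, if_neg hv]
        refine hd _ _ ?_
        rw [SimpleGraph.comap_adj, hq u hu, hq v hv]
        exact huv
  · rintro ⟨c, hc, hd⟩
    have := Fintype.ofFinite U
    have hle : weightedChromaticNumber (G.comap g) (fun u => w (g u)) ≤
        (Finset.univ.biUnion fun u => c (g u)).card :=
      weightedChromaticNumber_le_iff.2 <| WeightedColorable.of_finset (fun u => c (g u))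
        (fun u => hc _) (fun u v huv => hd _ _ huv) _
        fun u => Finset.subset_biUnion_of_mem (fun u => c (g u)) (Finset.mem_univ u)
    obtain ⟨T, hT, hTc⟩ := Finset.exists_subset_card_eq hle
    have key : ∀ x y, f x ∉ M → f y ∈ M → G.Adj (f x) (f y) → Disjoint (c (f x)) T := by
      intro x y hx hy hxy
      refine Disjoint.mono_right hT ((Finset.disjoint_biUnion_right _ _ _).2 fun u _ => hd _ _ ?_)
      have hu : g u ∈ M := hgM ▸ Set.mem_range_self u
      exact (adj_iff _ _ hx hu).2 ((adj_iff _ _ hx hy).1 hxy)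
    refine ⟨fun x => if f x ∈ M then T else c (f x), fun x => ?_, fun x y hxy => ?_⟩
    · by_cases hx : f x ∈ M
      · simp only [if_pos hx]; rw [hTc, hw' x hx]
      · simp only [if_neg hx]; rw [hc, hw x hx]
    · rw [SimpleGraph.comap_adj] at hxy
      by_cases hx : f x ∈ M <;> by_cases hy : f y ∈ M
      · exact (not_adj x y hx hy hxy).elim
      · simp only [if_pos hx, if_neg hy]
        exact (key y x hy hx hxy.symm).symm
      · simp only [if_neg hx, if_pos hy]
        exact key x y hx hy hxy
      · simp only [if_neg hx, if_neg hy]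
        exact hd _ _ hxy

end Coloring

/-! ### Modules -/

section Module

variable {V U : Type*}

/-- A module of the subgraph induced by a module is a module. -/
theorem IsModule.image {G : SimpleGraph V} {M : Set V} (hM : IsModule G M) {g : U → V}
    (hgM : Set.range g = M) {N : Set U} (hN : IsModule (G.comap g) N) : IsModule G (g '' N) := by
  intro x hx
  by_cases hxM : x ∈ M
  · obtain ⟨u, rfl⟩ : x ∈ Set.range g := hgM ▸ hxM
    have hu : u ∉ N := fun h => hx ⟨u, h, rfl⟩
    rcases hN u hu with h | h
    · exact .inl (by rintro _ ⟨v, hv, rfl⟩; exact h v hv)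
    · exact .inr (by rintro _ ⟨v, hv, rfl⟩; exact h v hv)
  · have hsub : ∀ y ∈ g '' N, y ∈ M := by
      rintro _ ⟨v, -, rfl⟩
      exact hgM ▸ Set.mem_range_self v
    exact (hM x hxM).imp (fun h y hy => h y (hsub y hy)) fun h y hy => h y (hsub y hy)

/-- The subgraph induced by a minimal module is prime. -/
theorem isPrime_comap {G : SimpleGraph V} {M : Set V} (hM : IsModule G M)
    (hmin : ∀ N, IsModule G N → N.Nontrivial → N ⊆ M → N = M) {g : U → V}
    (hg : Function.Injective g) (hgM : Set.range g = M) : IsPrime (G.comap g) := by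
  rintro N ⟨hN, hN', hne⟩
  refine hne ?_
  have := hmin _ (hM.image hgM hN) (hN'.image hg) (hgM ▸ Set.image_subset_range _ _)
  rw [← hgM, ← Set.image_univ] at this
  exact hg.image_injective this

theorem hereditary_primeClosure (X : Set FinGraph) : Hereditary (primeClosure X) := by
  rintro G hG H ⟨e⟩ K ⟨e'⟩ hK
  exact hG K ⟨e'.trans e⟩ hK

end Module

open PolyTime

/-! ### Masks and tables of graphs -/

section Mask

open Classical in
/-- A set of vertices as a list of marks. -/
noncomputable def mask {n : ℕ} (s : Set (Fin n)) : List Bool :=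
  (List.finRange n).map fun x => decide (x ∈ s)

/-- The adjacency table of a weighted graph: the neighborhood and the weight of each vertex. -/
noncomputable def table {n : ℕ} (G : SimpleGraph (Fin n)) (w : Fin n → ℕ) : List Row :=
  (List.finRange n).map fun i => (mask (G.neighborSet i), Computability.encodeNat (w i))

open Classical in
/-- The elements of a set of vertices in increasing order. -/
noncomputable def vertexList {n : ℕ} (s : Set (Fin n)) : List (Fin n) :=
  (List.finRange n).filter fun x => decide (x ∈ s)

variable {n : ℕ}

theorem length_mask (s : Set (Fin n)) : (mask s).length = n := by simp [mask]

theorem length_table (G : SimpleGraph (Fin n)) (w : Fin n → ℕ) : (table G w).length = n := by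
  simp [table]

theorem mem_vertexList {s : Set (Fin n)} {x : Fin n} : x ∈ vertexList s ↔ x ∈ s := by
  simp [vertexList]

theorem get_vertexList_injective (s : Set (Fin n)) : Function.Injective (vertexList s).get :=
  List.nodup_iff_injective_get.1 ((List.nodup_finRange n).filter _)

theorem range_get_vertexList (s : Set (Fin n)) : Set.range (vertexList s).get = s := by
  ext x
  exact (List.mem_iff_get.symm).trans mem_vertexList

theorem mask_congr {p : Fin n → Bool} {s : Set (Fin n)} (h : ∀ x, p x = true ↔ x ∈ s) :
    (List.finRange n).map p = mask s :=
  List.map_congr_left fun x _ => by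
    classical
    exact Bool.eq_iff_iff.2 ((h x).trans decide_eq_true_iff.symm)

theorem zip_map_self {α β γ : Type*} (l : List α) (f : α → β) (g : α → γ) :
    (l.map f).zip (l.map g) = l.map fun x => (f x, g x) := by
  induction l with
  | nil => rfl
  | cons a l ih => simp [ih]

open Classical in
theorem map_zip_mask {α : Type*} (f : Fin n → α) (s : Set (Fin n)) :
    ((List.finRange n).map f).zip (mask s) =
      (List.finRange n).map fun x => (f x, decide (x ∈ s)) :=
  zip_map_self _ _ _

theorem meets_mask (s t : Set (Fin n)) :
    meets (mask s) (mask t) = true ↔ (s ∩ t).Nonempty := by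
  rw [meets, mask, mask, zip_map_self]
  simp [Set.Nonempty]

theorem misses_mask (s t : Set (Fin n)) :
    misses (mask s) (mask t) = true ↔ ¬ t ⊆ s := by
  rw [misses, mask, mask, zip_map_self]
  simp [Set.not_subset, and_comm]

theorem maskFilter_mask {α : Type*} (s : Set (Fin n)) (f : Fin n → α) :
    maskFilter (mask s) ((List.finRange n).map f) = (vertexList s).map f := by
  classical
  rw [maskFilter, mask, zip_map_self, vertexList, List.flatMap_map]
  induction List.finRange n with
  | nil => rfl
  | cons a l ih =>
    rw [List.flatMap_cons, ih, List.filter_cons]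
    by_cases h : a ∈ s <;> simp [h]

theorem map_vertexList {α : Type*} (s : Set (Fin n)) (f : Fin n → α) :
    (vertexList s).map f =
      (List.finRange (vertexList s).length).map fun i => f ((vertexList s).get i) := by
  conv_lhs => rw [← List.map_get_finRange (vertexList s), List.map_map]
  rfl

theorem subTable_mask (s : Set (Fin n)) (G : SimpleGraph (Fin n)) (w : Fin n → ℕ) :
    subTable (mask s) (table G w) =
      table (G.comap (vertexList s).get) fun i => w ((vertexList s).get i) := by
  rw [subTable, table, List.map_map, maskFilter_mask, map_vertexList]
  refine List.map_congr_left fun i _ => ?_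
  simp only [Function.comp_apply]
  congr 1
  rw [mask, mask, ← mask, maskFilter_mask, map_vertexList]
  rfl

end Mask

/-! ### Computing a minimal module -/

section Close

variable {n : ℕ}

/-- The set `s` together with the vertices that distinguish between elements of `s`. -/
def addSplitters {V : Type*} (G : SimpleGraph V) (s : Set V) : Set V :=
  s ∪ {x | (G.neighborSet x ∩ s).Nonempty ∧ ¬ s ⊆ G.neighborSet x}

theorem closeStep_mask (G : SimpleGraph (Fin n)) (w : Fin n → ℕ) (s : Set (Fin n)) :
    closeStep (table G w) (mask s) = mask (addSplitters G s) := by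
  classical
  rw [closeStep, table]
  rw [map_zip_mask, List.map_map]
  refine mask_congr fun x => ?_
  simp only [Function.comp_apply, Bool.or_eq_true, Bool.and_eq_true, meets_mask, misses_mask,
    decide_eq_true_iff]
  rfl

theorem closeTable_mask (G : SimpleGraph (Fin n)) (w : Fin n → ℕ) (s : Set (Fin n)) :
    closeTable (table G w) (mask s) = mask ((addSplitters G)^[n] s) := by
  rw [closeTable, List.foldl_const, length_table]
  have key : ∀ k, (closeStep (table G w))^[k] (mask s) = mask ((addSplitters G)^[k] s) := by
    intro k
    induction k with
    | zero => rfl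
    | succ k ih =>
      rw [Function.iterate_succ_apply', Function.iterate_succ_apply', ih, closeStep_mask]
  exact key n

theorem subset_addSplitters {V : Type*} (G : SimpleGraph V) (s : Set V) : s ⊆ addSplitters G s :=
  Set.subset_union_left

theorem isModule_of_addSplitters {V : Type*} {G : SimpleGraph V} {s : Set V}
    (h : addSplitters G s = s) : IsModule G s := by
  intro x hx
  by_contra! hc
  obtain ⟨⟨y, hy, hxy⟩, z, hz, hxz⟩ := hc
  exact hx (h ▸ Or.inr ⟨⟨z, hxz, hz⟩, fun h' => hxy (h' hy)⟩)

theorem IsModule.addSplitters_subset {V : Type*} {G : SimpleGraph V} {M s : Set V}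
    (hM : IsModule G M) (hs : s ⊆ M) : addSplitters G s ⊆ M := by
  rintro x (hx | ⟨⟨y, hxy, hy⟩, h⟩)
  · exact hs hx
  · by_contra hxM
    rcases hM x hxM with h' | h'
    · exact h fun z hz => h' z (hs hz)
    · exact h' y (hs hy) hxy

/-- The closure of a set in a graph with `n` vertices is reached after `n` steps. -/
theorem isModule_iterate_addSplitters (G : SimpleGraph (Fin n)) (s : Set (Fin n)) :
    IsModule G ((addSplitters G)^[n] s) := by
  refine isModule_of_addSplitters ?_
  have key : ∀ k, addSplitters G ((addSplitters G)^[k] s) = (addSplitters G)^[k] s ∨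
      k ≤ ((addSplitters G)^[k] s).ncard := by
    intro k
    induction k with
    | zero => exact .inr (Nat.zero_le _)
    | succ k ih =>
      rw [Function.iterate_succ_apply']
      rcases ih with h | h
      · exact .inl (by rw [h, h])
      · by_cases h' : addSplitters G ((addSplitters G)^[k] s) = (addSplitters G)^[k] s
        · exact .inl (by rw [h', h'])
        · exact .inr (h.trans_lt (Set.ncard_lt_ncard
            ((subset_addSplitters G _).ssubset_of_ne (Ne.symm h')) (Set.toFinite _)))
  rcases key n with h | h
  · exact h
  · have : (addSplitters G)^[n] s = Set.univ :=
      Set.eq_of_subset_of_ncard_le (Set.subset_univ _)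
        (by rwa [Set.ncard_univ, Nat.card_eq_fintype_card, Fintype.card_fin]) (Set.toFinite _)
    rw [this]
    exact Set.univ_subset_iff.1 (subset_addSplitters G _)

theorem subset_iterate_addSplitters {V : Type*} (G : SimpleGraph V) (s : Set V) (k : ℕ) :
    s ⊆ (addSplitters G)^[k] s := by
  induction k with
  | zero => exact subset_rfl
  | succ k ih =>
    rw [Function.iterate_succ_apply']
    exact ih.trans (subset_addSplitters G _)

theorem IsModule.iterate_addSplitters_subset {V : Type*} {G : SimpleGraph V} {M s : Set V}
    (hM : IsModule G M) (hs : s ⊆ M) (k : ℕ) : (addSplitters G)^[k] s ⊆ M := by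
  induction k with
  | zero => exact hs
  | succ k ih =>
    rw [Function.iterate_succ_apply']
    exact hM.addSplitters_subset ih

theorem leastMask_mask (s : Set (Fin n)) (L : List (Set (Fin n))) :
    ∃ t, leastMask (mask s) (L.map mask) = mask t ∧ (t = s ∨ t ∈ L) ∧ t ⊆ s ∧
      ∀ c ∈ L, c ⊆ t → t ⊆ c := by
  induction L generalizing s with
  | nil => exact ⟨s, rfl, .inl rfl, subset_rfl, by simp⟩
  | cons c L ih =>
    by_cases h : c ⊆ s
    · obtain ⟨t, ht, h₁, h₂, h₃⟩ := ih c
      refine ⟨t, ?_, .inr ?_, h₂.trans h, ?_⟩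
      · rw [← ht, leastMask, List.map_cons, List.foldl_cons,
          Bool.eq_false_iff.2 fun h' => (misses_mask s c).1 h' h]
        rfl
      · rcases h₁ with rfl | h₁ <;> simp [*]
      · rintro d hd hdt
        rcases List.mem_cons.1 hd with rfl | hd
        · exact h₂
        · exact h₃ d hd hdt
    · obtain ⟨t, ht, h₁, h₂, h₃⟩ := ih s
      refine ⟨t, ?_, h₁.imp_right (List.mem_cons_of_mem _), h₂, ?_⟩
      · rw [← ht, leastMask, List.map_cons, List.foldl_cons, (misses_mask s c).2 h]
        rfl
      · rintro d hd hdt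
        rcases List.mem_cons.1 hd with rfl | hd
        · exact (h (hdt.trans h₂)).elim
        · exact h₃ d hd hdt

theorem unitMasks_table (G : SimpleGraph (Fin n)) (w : Fin n → ℕ) :
    unitMasks (table G w) = (List.finRange n).map fun u => mask {u} := by
  rw [unitMasks_eq _ (length_table G w)]
  exact List.map_congr_left fun u _ => mask_congr fun x => by simp

theorem pairMasks_mask : ∃ L : List (Set (Fin n)),
    pairMasks ((List.finRange n).map fun u => mask {u}) = L.map mask ∧
      ∀ s, s ∈ L ↔ ∃ u v, u ≠ v ∧ s = {u, v} := by
  refine ⟨(List.finRange n).flatMap fun u => (List.finRange n).flatMap fun v =>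
    if u = v then [] else [{u, v}], ?_, ?_⟩
  · rw [pairMasks, List.flatMap_map, List.map_flatMap]
    refine List.flatMap_congr fun u _ => ?_
    rw [List.flatMap_map, List.map_flatMap]
    refine List.flatMap_congr fun v _ => ?_
    by_cases h : u = v
    · rw [if_pos h, (meets_mask _ _).2 (by simp [h])]
      rfl
    · have : meets (mask {u}) (mask {v}) = false :=
        Bool.eq_false_iff.2 fun h' => h (by
          have := (meets_mask _ _).1 h'
          simpa [eq_comm] using this)
      rw [if_neg h, this]
      simp only [cond_false, List.map_cons, List.map_nil]
      congr 1
      rw [mask, mask, zip_map_self, List.map_map]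
      exact mask_congr fun x => by simp
  · intro s
    simp only [List.mem_flatMap, List.mem_finRange, true_and]
    refine exists_congr fun u => exists_congr fun v => ?_
    by_cases h : u = v <;> simp [h]

/-- The mask found is the mask of a minimal module. -/
theorem moduleMask_table (G : SimpleGraph (Fin n)) (w : Fin n → ℕ) :
    ∃ M, moduleMask (table G w) = mask M ∧ IsModule G M ∧ (M = Set.univ ∨ M.Nontrivial) ∧
      ∀ N, IsModule G N → N.Nontrivial → N ⊆ M → N = M := by
  obtain ⟨L, hL, hmem⟩ := pairMasks_mask (n := n)
  obtain ⟨M, hM, h₁, h₂, h₃⟩ := leastMask_mask (Set.univ : Set (Fin n))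
    (L.map fun s => (addSplitters G)^[n] s)
  have hcl : ∀ c ∈ L.map fun s => (addSplitters G)^[n] s, IsModule G c ∧ c.Nontrivial := by
    intro c hc
    obtain ⟨s, hs, rfl⟩ := List.mem_map.1 hc
    obtain ⟨u, v, huv, rfl⟩ := (hmem s).1 hs
    exact ⟨isModule_iterate_addSplitters G _,
      (Set.nontrivial_pair huv).mono (subset_iterate_addSplitters G _ _)⟩
  refine ⟨M, ?_, ?_, ?_, ?_⟩
  · rw [← hM, moduleMask, unitMasks_table, hL, List.map_map, List.map_map]
    congr 1
    · rw [table, List.map_map]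
      exact mask_congr fun x => by simp
    · exact List.map_congr_left fun s _ => closeTable_mask G w s
  · rcases h₁ with rfl | h₁
    · exact fun x hx => (hx trivial).elim
    · exact (hcl M h₁).1
  · exact h₁.imp_right fun h => (hcl M h).2
  · rintro N hN ⟨u, hu, v, hv, huv⟩ hNM
    have hs : {u, v} ⊆ N := Set.insert_subset hu (Set.singleton_subset_iff.2 hv)
    have hc := hN.iterate_addSplitters_subset hs n
    exact hNM.antisymm ((h₃ _ (List.mem_map.2 ⟨_, (hmem _).2 ⟨u, v, huv, rfl⟩, rfl⟩)
      (hc.trans hNM)).trans hc)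

theorem repMask_mask {s : Set (Fin n)} (hs : s.Nonempty) :
    ∃ r ∈ s, repMask ((List.finRange n).map fun u => mask {u}) (mask s) = mask {r} := by
  have key : ∀ (l : List (Fin n)) (m : List Bool),
      (∃ r ∈ s, (l.map fun u => mask {u}).foldl (fun r u => bif meets u (mask s) then u else r) m =
        mask {r}) ∨ ((l.map fun u => mask {u}).foldl
          (fun r u => bif meets u (mask s) then u else r) m = m ∧ ∀ u ∈ l, u ∉ s) := by
    intro l
    induction l with
    | nil => exact fun m => .inr ⟨rfl, by simp⟩
    | cons u l ih =>
      intro m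
      rw [List.map_cons, List.foldl_cons]
      by_cases hu : u ∈ s
      · rw [(meets_mask {u} s).2 ⟨u, rfl, hu⟩, cond_true]
        exact .inl ((ih (mask {u})).elim id fun h => ⟨u, hu, h.1⟩)
      · have : meets (mask {u}) (mask s) = false :=
          Bool.eq_false_iff.2 fun h => hu (by simpa using (meets_mask _ _).1 h)
        rw [this, cond_false]
        refine (ih m).imp_right fun h => ⟨h.1, ?_⟩
        simpa [hu] using h.2
  rcases key (List.finRange n) ((mask s).map fun _ => false) with h | ⟨-, h⟩
  · exact h
  · obtain ⟨x, hx⟩ := hs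
    exact (h x (List.mem_finRange x) hx).elim

open Classical in
theorem contractTable_mask (G : SimpleGraph (Fin n)) (w : Fin n → ℕ) {M : Set (Fin n)} {r : Fin n}
    (hr : repMask (unitMasks (table G w)) (mask M) = mask {r}) (k : ℕ) :
    contractTable (table G w) (mask M) (Computability.encodeNat k) =
      subTable (mask {x | x ∉ M ∨ x = r}) (table G fun x => if x ∈ M then k else w x) := by
  rw [contractTable, hr]
  congr 1
  · rw [mask, mask, zip_map_self, List.map_map]
    exact mask_congr fun x => by simp
  · rw [table]
    rw [map_zip_mask, List.map_map, table]
    refine List.map_congr_left fun x _ => ?_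
    by_cases h : x ∈ M <;> simp [h]

end Close

/-! ### Contracting a minimal module -/

section Contraction

variable {X : Set FinGraph}

theorem isInducedSubgraph_comap_get (G : FinGraph) (s : Set (Fin G.1)) :
    IsInducedSubgraph ⟨(vertexList s).length, G.2.comap (vertexList s).get⟩ G :=
  ⟨SimpleGraph.Embedding.comap ⟨_, get_vertexList_injective s⟩ G.2⟩

theorem length_vertexList_le {n : ℕ} (s : Set (Fin n)) : (vertexList s).length ≤ n :=
  (List.length_filter_le _ _).trans_eq (List.length_finRange)

theorem length_vertexList_lt {n : ℕ} {s : Set (Fin n)} {x : Fin n} (hx : x ∉ s) :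
    (vertexList s).length < n := by
  classical
  refine lt_of_lt_of_eq ?_ (List.length_finRange (n := n))
  exact List.length_filter_lt_length_iff_exists.2 ⟨x, List.mem_finRange x, by simpa using hx⟩

/-- The adjacency table of an instance. -/
noncomputable def WeightedInstance.table (I : WeightedInstance X) : List Row :=
  GraphColoring.table I.graph.2 I.weight

/-- One round of the algorithm: a prime induced subgraph `S` of an instance is solved, and in the
instance `J` it is replaced by one vertex. The last conjunct says that at the end, when at most one
vertex is left, `S` is the whole instance. -/
theorem exists_contraction (I : WeightedInstance (primeClosure X)) :
    ∃ (S : WeightedInstance X) (J : WeightedInstance (primeClosure X)),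
      S.table = subTable (moduleMask I.table) I.table ∧
      J.table = contractTable I.table (moduleMask I.table) (Computability.encodeNat S.answer) ∧
      J.answer = I.answer ∧ J.graph.1 ≤ I.graph.1 ∧ (2 ≤ I.graph.1 → J.graph.1 < I.graph.1) ∧
      (I.graph.1 ≤ 1 → S.answer = I.answer) := by
  classical
  obtain ⟨⟨n, G⟩, hG, w⟩ := I
  obtain ⟨M, hM, hmod, hM', hmin⟩ := moduleMask_table G w
  have hS : (⟨_, G.comap (vertexList M).get⟩ : FinGraph) ∈ X :=
    hG _ (isInducedSubgraph_comap_get ⟨n, G⟩ M)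
      (isPrime_comap hmod hmin (get_vertexList_injective M) (range_get_vertexList M))
  let S : WeightedInstance X := ⟨_, hS, fun i => w ((vertexList M).get i)⟩
  have hSt : S.table =
      subTable (moduleMask (GraphColoring.table G w)) (GraphColoring.table G w) := by
    rw [hM, subTable_mask]
    rfl
  have hSa : n ≤ 1 → S.answer = weightedChromaticNumber G w := by
    intro hn
    -- With at most one vertex, the module is not nontrivial, and so it is the whole vertex set.
    have hu : M = Set.univ := hM'.resolve_right fun ⟨u, _, v, _, huv⟩ => huv (by
      have := u.2
      have := v.2
      exact Fin.ext (by omega))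
    refine weightedChromaticNumber_congr fun k => weightedColorable_comap_iff
      ⟨get_vertexList_injective M, Set.range_eq_univ.1 ?_⟩
    rw [range_get_vertexList, hu]
  rcases Nat.eq_zero_or_pos n with rfl | hn
  -- Without vertices there is none to keep; the table is empty, and contraction leaves it empty.
  · refine ⟨S, ⟨⟨0, G⟩, hG, w⟩, hSt, ?_, rfl, le_rfl, fun h => absurd h (by simp), hSa⟩
    simp [WeightedInstance.table, GraphColoring.table, contractTable, subTable, maskFilter]
  · have hne : M.Nonempty := by
      rcases hM' with rfl | h
      · exact ⟨⟨0, hn⟩, trivial⟩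
      · exact h.nonempty
    obtain ⟨r, hr, hrep⟩ := repMask_mask hne
    rw [← unitMasks_table G w] at hrep
    let N : Set (Fin n) := {x | x ∉ M ∨ x = r}
    refine ⟨S, ⟨⟨(vertexList N).length, G.comap (vertexList N).get⟩,
      hereditary_primeClosure X _ hG _ (isInducedSubgraph_comap_get ⟨n, G⟩ N),
      fun i => if (vertexList N).get i ∈ M then S.answer else w ((vertexList N).get i)⟩, hSt, ?_,
      ?_, length_vertexList_le N, fun h2 => ?_, hSa⟩
    · change _ = contractTable (GraphColoring.table G w) (moduleMask (GraphColoring.table G w)) _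
      rw [hM, contractTable_mask G w hrep, subTable_mask]
      rfl
    · refine weightedChromaticNumber_contract hmod hr (range_get_vertexList M) (fun v => ?_)
        (fun x hx => if_neg hx) fun x hx => if_pos hx
      rw [range_get_vertexList]
      rfl
    · have : M.Nontrivial := by
        rcases hM' with rfl | h
        · exact ⟨⟨0, hn⟩, trivial, ⟨1, h2⟩, trivial, by simp⟩
        · exact h
      obtain ⟨x, hx, hxr⟩ := this.exists_ne r
      exact length_vertexList_lt (x := x) fun h => h.elim (fun h => h hx) hxr

end Contraction

end GraphColoring

namespace PolyTime
open Enc (enc)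

/-! ### Binary numbers -/

section Binary

/-- The number with the given binary digits, least significant digit first. -/
def bitVal : List Bool → ℕ
  | [] => 0
  | b :: l => b.toNat + 2 * bitVal l

theorem bitVal_encodePosNum (p : PosNum) : bitVal (Computability.encodePosNum p) = p := by
  induction p with
  | one => rfl
  | bit1 p ih => rw [Computability.encodePosNum, bitVal, ih, PosNum.cast_bit1]; simp; omega
  | bit0 p ih => rw [Computability.encodePosNum, bitVal, ih, PosNum.cast_bit0]; simp; omega

theorem bitVal_encodeNat (m : ℕ) : bitVal (Computability.encodeNat m) = m := by
  have : ∀ k : Num, bitVal (Computability.encodeNum k) = k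
    | .zero => rfl
    | .pos p => bitVal_encodePosNum p
  rw [Computability.encodeNat, this, Num.to_of_nat]

theorem bitVal_lt (l : List Bool) : bitVal l < 2 ^ l.length := by
  induction l with
  | nil => simp [bitVal]
  | cons b l ih =>
    have : b.toNat ≤ 1 := Bool.toNat_le b
    rw [bitVal, List.length_cons, pow_succ]
    omega

theorem length_encodeNat_le {m L : ℕ} (h : m < 2 ^ L) :
    (Computability.encodeNat m).length ≤ L := by
  have key : ∀ p : PosNum, 2 ^ (Computability.encodePosNum p).length ≤ 2 * (p : ℕ) := by
    intro p
    induction p with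
    | one => simp [Computability.encodePosNum]
    | bit1 p ih =>
      rw [Computability.encodePosNum, List.length_cons, pow_succ, PosNum.cast_bit1]; omega
    | bit0 p ih =>
      rw [Computability.encodePosNum, List.length_cons, pow_succ, PosNum.cast_bit0]; omega
  rw [Computability.encodeNat]
  rcases hk : (m : Num) with _ | p
  · simp [Computability.encodeNum]
  · have hm : (p : ℕ) = m := by
      have := Num.to_of_nat m
      rw [hk] at this
      exact this
    refine Nat.le_of_lt_succ ((Nat.pow_lt_pow_iff_right (a := 2) (by norm_num)).1 ?_)
    rw [pow_succ]
    have := key p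
    change 2 ^ (Computability.encodePosNum p).length < _
    omega

theorem lt_two_pow_length_encodeNat (m : ℕ) : m < 2 ^ (Computability.encodeNat m).length := by
  conv_lhs => rw [← bitVal_encodeNat m]
  exact bitVal_lt _

/-- Comparison of two numbers given by their binary digits. The shorter list is padded with zeros;
the last position where the digits differ decides. -/
def leBits (p q : List Bool) : Bool :=
  ((p ++ q.map fun _ => false).zip (q ++ p.map fun _ => false)).foldl
    (fun r x => bif x.1 then x.2 && r else x.2 || r) true

theorem bitVal_append_false {α : Type*} (l : List Bool) (l' : List α) :
    bitVal (l ++ l'.map fun _ => false) = bitVal l := by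
  induction l with
  | nil =>
    induction l' with
    | nil => rfl
    | cons a l' ih =>
      change false.toNat + 2 * bitVal (l'.map fun _ => false) = 0
      rw [show bitVal (l'.map fun _ => false) = 0 from ih]
      rfl
  | cons b l ih => rw [List.cons_append, bitVal, bitVal, ih]

theorem leBits_eq (p q : List Bool) : leBits p q = decide (bitVal p ≤ bitVal q) := by
  have key : ∀ (l l' : List Bool), l.length = l'.length → ∀ r : Bool,
      (l.zip l').foldl (fun r x => bif x.1 then x.2 && r else x.2 || r) r =
        decide (bitVal l < bitVal l' ∨ bitVal l = bitVal l' ∧ r = true) := by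
    intro l
    induction l with
    | nil =>
      intro l' h r
      rw [List.eq_nil_of_length_eq_zero h.symm]
      simp [bitVal]
    | cons a l ih =>
      intro l' h r
      cases l' with
      | nil => simp at h
      | cons b l' =>
        rw [List.zip_cons_cons, List.foldl_cons, ih l' (by simpa using h), bitVal, bitVal,
          decide_eq_decide]
        cases a <;> cases b <;> cases r <;> simp <;> omega
  rw [leBits, key _ _ (by simp [Nat.add_comm]), bitVal_append_false, bitVal_append_false,
    decide_eq_decide, and_iff_left rfl]
  omega

variable {α γ : Type} [Enc α] [Enc γ]

theorem Poly.leBits {p q : γ → List Bool} (hp : Poly p) (hq : Poly q) :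
    Poly fun c => leBits (p c) (q c) :=
  Poly.foldl (init := fun _ => true)
    (step := fun _ (r : Bool) (x : Bool × Bool) => bif x.1 then x.2 && r else x.2 || r)
    ((hp.append (hq.map (f := fun _ (_ : Bool) => false) (.const false))).zip
      (hq.append (hp.map (f := fun _ (_ : Bool) => false) (.const false)))) (.const true)
    (Poly.snd'.fst.cond (Poly.snd'.snd.and Poly.fst'.snd) (Poly.snd'.snd.or Poly.fst'.snd)) 1
    fun _ _ _ => by simp

theorem size_reverse (l : List α) : size l.reverse = size l := by
  induction l with
  | nil => rfl
  | cons a l ih =>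
    rw [List.reverse_cons, size_append, ih]
    simp
    omega

theorem Poly.reverse {l : γ → List α} (hl : Poly l) : Poly fun c => (l c).reverse := by
  obtain ⟨p, hp⟩ := hl.exists_size_le
  have key : ∀ l s : List α, l.foldl (fun s a => [a] ++ s) s = l.reverse ++ s := by
    intro l
    induction l with
    | nil => intro s; rfl
    | cons a l ih => intro s; rw [List.foldl_cons, ih]; simp
  have := Poly.foldl (init := fun _ => ([] : List α)) (step := fun _ s a => [a] ++ s) hl (.const [])
    (Poly.snd'.singleton.append Poly.fst'.snd) p fun c l' hl' => ?_
  · simpa only [key, List.append_nil] using this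
  · rw [key, List.append_nil, size_reverse]
    exact (size_le_of_prefix hl').trans (hp c)

/-- Natural numbers are encoded in binary. -/
instance : Enc ℕ where
  Γ := Bool
  fin := inferInstance
  inh := inferInstance
  enc := Computability.encodeNat

theorem Poly.encodeNat {f : γ → ℕ} (hf : Poly f) : Poly fun c => Computability.encodeNat (f c) :=
  (Poly.of_flatMap (α := ℕ) (β := List Bool) (f := Computability.encodeNat)
    (fun b => [some b, none]) [] fun m => by simp [enc]; rfl).comp hf

end Binary

end PolyTime

namespace GraphColoring
open PolyTime
open PolyTime.Enc (enc)
open Computability (Γ' encodeNat)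

/-! ### Encodings of instances -/

section Encodings

variable {X : Set FinGraph} {γ : Type} [Enc γ]

noncomputable instance : Enc (WeightedInstance X) where
  Γ := Γ'
  fin := inferInstance
  inh := inferInstance
  enc := WeightedInstance.encode

noncomputable instance : Enc (ColoringInstance X) where
  Γ := Γ'
  fin := inferInstance
  inh := inferInstance
  enc := ColoringInstance.encode

/-- The instances of the weighted coloring problem, encoded as adjacency tables. This is a type
synonym, since `WeightedInstance X` carries the encoding of the problem statement. -/
def TableInstance (X : Set FinGraph) : Type := WeightedInstance X

/-- The underlying instance. -/
abbrev TableInstance.inst (I : TableInstance X) : WeightedInstance X := I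

noncomputable instance : Enc (TableInstance X) where
  Γ := Enc.Γ (List Row)
  fin := Enc.fin
  inh := Enc.inh
  enc I := enc I.inst.table

theorem poly_table : Poly fun I : TableInstance X => I.inst.table :=
  computable_congr (f := fun I : List Row => I) (ea := enc) (eb := enc) Poly.id
    (fun I : TableInstance X => I.inst.table) (fun _ => rfl) fun _ => rfl

/-- A function into instances is computable if the table of its value is. -/
theorem poly_of_table {f : γ → TableInstance X} (h : Poly fun c => (f c).inst.table) : Poly f :=
  computable_congr (f := fun c => (f c).inst.table) (ea := enc) (eb := enc) h id
    (fun _ => rfl) fun _ => rfl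

theorem rowCode_eq {n : ℕ} (G : SimpleGraph (Fin n)) (i : Fin n) :
    rowCode G i = (mask (G.neighborSet i)).map Γ'.bit := by
  rw [mask, List.map_map]
  rfl

/-- The transducer that reads a code of an instance and emits the code of its table. The state
tells whether a weight is being read. -/
def parseStep : Bool → Γ' → Bool × List (Enc.Γ (List Row))
  | false, .bit b => (false, [some (.inl (some b)), some (.inl none)])
  | true, .bit b => (true, [some (.inr (some b)), some (.inr none)])
  | false, .comma => (true, [])
  | true, .comma => (false, [none])
  | q, _ => (q, [])

/-- The transducer that reads the code of a table and emits the code of an instance. The state tells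
whether a weight is being read. -/
def printStep : Bool → Enc.Γ (List Row) → Bool × List Γ'
  | false, some (.inl (some b)) => (false, [.bit b])
  | false, some (.inr (some b)) => (true, [.comma, .bit b])
  | true, some (.inr (some b)) => (true, [.bit b])
  | false, none => (false, [.comma, .comma])
  | true, none => (false, [.comma])
  | q, _ => (q, [])

theorem enc_row (r : Row) : enc r = (enc r.1).map .inl ++ (enc r.2).map .inr := rfl

theorem poly_parse : Poly fun I : WeightedInstance X => I.table := by
  refine Poly.of_transduce false parseStep (fun _ => []) fun I => ?_
  change transduce _ _ _ I.encode = _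
  rw [WeightedInstance.encode, WeightedInstance.table, table]
  induction List.finRange I.graph.1 with
  | nil => rfl
  | cons i l ih =>
    have h₁ : ∀ (p : List Bool) (r : List Γ'),
        transduce parseStep (fun _ => []) false (p.map .bit ++ r) =
          ((enc p).map .inl).map some ++ transduce parseStep (fun _ => []) false r := by
      intro p r
      induction p with
      | nil => rfl
      | cons b p ih => rw [enc_cons]; simpa [transduce, parseStep, enc_bool] using ih
    have h₂ : ∀ (p : List Bool) (r : List Γ'),
        transduce parseStep (fun _ => []) true (p.map .bit ++ r) =
          ((enc p).map .inr).map some ++ transduce parseStep (fun _ => []) true r := by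
      intro p r
      induction p with
      | nil => rfl
      | cons b p ih => rw [enc_cons]; simpa [transduce, parseStep, enc_bool] using ih
    rw [List.flatMap_cons, List.map_cons, enc_cons, ← ih, rowCode_eq, natCode, enc_row]
    simp only [List.append_assoc, List.cons_append, List.nil_append, List.map_append]
    rw [h₁]
    congr 1
    exact h₂ _ _

theorem poly_print : Poly fun I : TableInstance X => I.inst := by
  refine Poly.of_transduce false printStep (fun _ => []) fun I => ?_
  change transduce _ _ _ (enc I.inst.table) = I.inst.encode
  rw [WeightedInstance.encode, WeightedInstance.table, table]
  induction List.finRange I.inst.graph.1 with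
  | nil => rfl
  | cons i l ih =>
    have h₁ : ∀ (p : List Bool) (r : List (Enc.Γ (List Row))),
        transduce printStep (fun _ => []) false (((enc p).map .inl).map some ++ r) =
          p.map .bit ++ transduce printStep (fun _ => []) false r := by
      intro p r
      induction p with
      | nil => rfl
      | cons b p ih => rw [enc_cons]; simpa [transduce, printStep, enc_bool] using ih
    have h₂ : ∀ (p : List Bool) (r : List (Enc.Γ (List Row))),
        transduce printStep (fun _ => []) true (((enc p).map .inr).map some ++ r) =
          p.map .bit ++ transduce printStep (fun _ => []) true r := by
      intro p r
      induction p with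
      | nil => rfl
      | cons b p ih => rw [enc_cons]; simpa [transduce, printStep, enc_bool] using ih
    have h₃ : ∀ (p : List Bool) (r : List (Enc.Γ (List Row))),
        transduce printStep (fun _ => []) false (((enc p).map .inr).map some ++ none :: r) =
          .comma :: (p.map .bit ++ .comma :: transduce printStep (fun _ => []) false r) := by
      intro p r
      cases p with
      | nil => rfl
      | cons b p =>
        have := h₂ p (none :: r)
        rw [enc_cons]
        simpa [transduce, printStep, enc_bool] using this
    rw [List.map_cons, enc_cons, enc_row, List.map_append, List.append_assoc, h₁, h₃, ih,
      List.flatMap_cons, rowCode_eq, natCode]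
    simp

/-- The strings between the commas in the code of an instance of the coloring problem. -/
noncomputable def ColoringInstance.segments (I : ColoringInstance X) : List (List Bool) :=
  (List.finRange I.graph.1).map (fun i => mask (I.graph.2.neighborSet i)) ++ [encodeNat I.colors]

/-- The transducer that splits the code of an instance at the commas. -/
def splitStep (q : Unit) : Γ' → Unit × List (Enc.Γ (List (List Bool)))
  | .bit b => (q, [some (some b), some none])
  | .comma => (q, [none])
  | _ => (q, [])

theorem poly_segments : Poly (ColoringInstance.segments (X := X)) := by
  refine Poly.of_transduce () splitStep (fun _ => [none]) fun I => ?_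
  change transduce _ _ _ I.encode = _
  rw [ColoringInstance.encode, ColoringInstance.segments]
  have h : ∀ (p : List Bool) (r : List Γ'),
      transduce splitStep (fun _ => [none]) () (p.map .bit ++ r) =
        (enc p).map some ++ transduce splitStep (fun _ => [none]) () r := by
    intro p r
    induction p with
    | nil => rfl
    | cons b p ih => rw [enc_cons]; simpa [transduce, splitStep, enc_bool] using ih
  induction List.finRange I.graph.1 with
  | nil =>
    have := h (encodeNat I.colors) []
    rw [List.append_nil] at this
    rw [List.flatMap_nil, List.nil_append, natCode, this, List.map_nil, List.nil_append, enc_cons]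
    rfl
  | cons i l ih =>
    rw [List.flatMap_cons, List.map_cons, List.cons_append, enc_cons, ← ih, rowCode_eq]
    simp only [List.append_assoc, List.cons_append, List.nil_append]
    rw [h]
    rfl

/-- The instance of the weighted coloring problem with the same graph and all weights `1`. -/
def ColoringInstance.weighted (I : ColoringInstance X) : TableInstance X :=
  (⟨I.graph, I.graph_mem, fun _ => 1⟩ : WeightedInstance X)

theorem poly_weighted : Poly (ColoringInstance.weighted (X := X)) := by
  refine poly_of_table ?_
  -- All segments but the last are the rows of the adjacency matrix.
  have := (poly_segments (X := X)).reverse.tail.reverse.map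
    (f := fun _ (r : List Bool) => ((r, [true]) : Row)) (Poly.snd'.pair (.const [true]))
  simp only [ColoringInstance.segments, List.reverse_append, List.reverse_singleton,
    List.cons_append, List.nil_append, List.tail_cons, List.reverse_reverse, List.map_map] at this
  have h : encodeNat 1 = [true] := by
    rw [encodeNat, Nat.cast_one]
    rfl
  rw [← h] at this
  exact this

/-- The number of colors is the last segment. -/
theorem poly_colors : Poly fun I : ColoringInstance X => encodeNat I.colors := by
  have := (poly_segments (X := X)).reverse.take_one.flatten
  simpa [ColoringInstance.segments] using this

end Encodings

/-! ### The algorithm -/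

section Algorithm

variable {X : Set FinGraph}

/-- The subgraph induced by a minimal module. -/
noncomputable def primePart (I : TableInstance (primeClosure X)) : TableInstance X :=
  (exists_contraction I.inst).choose

/-- The instance in which that module is replaced by one vertex. -/
noncomputable def contract (I : TableInstance (primeClosure X)) : TableInstance (primeClosure X) :=
  (exists_contraction I.inst).choose_spec.choose

theorem contract_spec (I : TableInstance (primeClosure X)) :
    (primePart I).inst.table = subTable (moduleMask I.inst.table) I.inst.table ∧
      (contract I).inst.table = contractTable I.inst.table (moduleMask I.inst.table)
        (encodeNat (primePart I).inst.answer) ∧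
      (contract I).inst.answer = I.inst.answer ∧
      (contract I).inst.graph.1 ≤ I.inst.graph.1 ∧
      (2 ≤ I.inst.graph.1 → (contract I).inst.graph.1 < I.inst.graph.1) ∧
      (I.inst.graph.1 ≤ 1 → (primePart I).inst.answer = I.inst.answer) :=
  (exists_contraction I.inst).choose_spec.choose_spec

theorem poly_primePart : Poly (primePart (X := X)) := by
  refine poly_of_table ?_
  simp only [(contract_spec _).1]
  exact poly_table.moduleMask.subTable poly_table

theorem poly_contract (h : Poly fun I : WeightedInstance X => I.answer) :
    Poly (contract (X := X)) := by
  refine poly_of_table ?_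
  simp only [(contract_spec _).2.1]
  exact poly_table.contractTable poly_table.moduleMask
    (h.comp (poly_print.comp poly_primePart)).encodeNat

theorem answer_iterate (I : TableInstance (primeClosure X)) (k : ℕ) :
    (contract^[k] I).inst.answer = I.inst.answer := by
  induction k with
  | zero => rfl
  | succ k ih => rw [Function.iterate_succ_apply', (contract_spec _).2.2.1, ih]

theorem order_iterate_le (I : TableInstance (primeClosure X)) (k : ℕ) :
    (contract^[k] I).inst.graph.1 ≤ I.inst.graph.1 := by
  induction k with
  | zero => rfl
  | succ k ih =>
    rw [Function.iterate_succ_apply']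
    exact (contract_spec _).2.2.2.1.trans ih

theorem order_iterate (I : TableInstance (primeClosure X)) (k : ℕ) :
    (contract^[k] I).inst.graph.1 ≤ 1 ∨
      (contract^[k] I).inst.graph.1 + k ≤ I.inst.graph.1 := by
  induction k with
  | zero => exact .inr le_rfl
  | succ k ih =>
    rw [Function.iterate_succ_apply']
    have h₁ := (contract_spec (contract^[k] I)).2.2.2.1
    have h₂ := (contract_spec (contract^[k] I)).2.2.2.2.1
    omega

theorem length_table_inst (I : TableInstance X) : I.inst.table.length = I.inst.graph.1 :=
  length_table _ _

theorem order_le_size (I : TableInstance X) : I.inst.graph.1 ≤ size I :=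
  (length_table_inst I).symm.trans_le (length_le_size I.inst.table)

theorem size_row (I : WeightedInstance X) (i : Fin I.graph.1) :
    size ((mask (I.graph.2.neighborSet i), encodeNat (I.weight i)) : Row) =
      2 * I.graph.1 + 2 * (encodeNat (I.weight i)).length := by
  rw [size_prod, size_listBool, size_listBool, length_mask]

/-- The weights of an instance are bounded by its answer. -/
theorem size_le_of_answer_lt (I : TableInstance X) {L : ℕ} (h : I.inst.answer < 2 ^ L) :
    size I ≤ I.inst.graph.1 * (2 * I.inst.graph.1 + 2 * L + 1) := by
  change size I.inst.table ≤ _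
  refine (size_map_le (N := 2 * I.inst.graph.1 + 2 * L) _ fun i _ => ?_).trans ?_
  · rw [size_row]
    have := length_encodeNat_le ((weight_le_weightedChromaticNumber I.inst.graph.2
      I.inst.weight i).trans_lt h)
    omega
  · rw [List.length_finRange]

/-- A crude bound: at most `size I` weights, each less than `2 ^ size I`. -/
theorem answer_lt (I : TableInstance X) : I.inst.answer < 2 ^ (2 * size I) := by
  have hw : ∀ i, I.inst.weight i ≤ 2 ^ size I := by
    intro i
    refine (lt_two_pow_length_encodeNat _).le.trans (Nat.pow_le_pow_right two_pos ?_)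
    have h := size_le_of_mem (l := I.inst.table) (List.mem_map.2 ⟨i, List.mem_finRange i, rfl⟩)
    rw [size_row] at h
    change _ ≤ size I.inst.table
    omega
  have hn : I.inst.graph.1 < 2 ^ size I := (order_le_size I).trans_lt Nat.lt_two_pow_self
  calc I.inst.answer ≤ ∑ i, I.inst.weight i := weightedChromaticNumber_le_sum _ _
    _ ≤ ∑ _i : Fin I.inst.graph.1, 2 ^ size I := Finset.sum_le_sum fun i _ => hw i
    _ = I.inst.graph.1 * 2 ^ size I := by simp
    _ < 2 ^ size I * 2 ^ size I := Nat.mul_lt_mul_of_pos_right hn (by positivity)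
    _ = 2 ^ (2 * size I) := by rw [two_mul, pow_add]

/-- The instances that occur in the course of the algorithm do not grow: their weights are bounded
by their weighted chromatic number, which is that of the input. -/
theorem size_iterate_le (I : TableInstance (primeClosure X)) (k : ℕ) :
    size (contract^[k] I) ≤ size I * (6 * size I + 1) := by
  have h : (contract^[k] I).inst.answer < 2 ^ (2 * size I) := answer_iterate I k ▸ answer_lt I
  have hn := (order_iterate_le I k).trans (order_le_size I)
  exact (size_le_of_answer_lt _ h).trans (Nat.mul_le_mul hn (by omega))

/-- Contracting as many times as there are vertices leaves an instance with at most one vertex. -/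
theorem answer_primePart_iterate (I : TableInstance (primeClosure X)) :
    (primePart (contract^[I.inst.graph.1] I)).inst.answer = I.inst.answer := by
  rw [(contract_spec _).2.2.2.2.2, answer_iterate]
  have := order_iterate I I.inst.graph.1
  omega

/-- An algorithm for `X` yields one for `primeClosure X`. -/
theorem poly_answer (h : Poly fun I : WeightedInstance X => I.answer) :
    Poly fun I : TableInstance (primeClosure X) => I.inst.answer := by
  have hloop : Poly fun I : TableInstance (primeClosure X) =>
      I.inst.table.foldl (fun J _ => contract J) I := by
    refine Poly.foldl (step := fun _ J _ => contract J) poly_table .id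
      ((poly_contract h).comp Poly.fst'.snd) (.X * (6 * .X + 1)) fun I l' hl' => ?_
    rw [List.foldl_const]
    simpa using size_iterate_le I l'.length
  have := h.comp (poly_print.comp (poly_primePart.comp hloop))
  simp only [List.foldl_const, length_table_inst, answer_primePart_iterate] at this
  exact this

theorem coloring_answer_eq (I : ColoringInstance X) :
    I.answer = leBits (encodeNat I.weighted.inst.answer) (encodeNat I.colors) := by
  rw [leBits_eq, bitVal_encodeNat, bitVal_encodeNat, ColoringInstance.answer, decide_eq_decide,
    SimpleGraph.chromaticNumber_le_iff_colorable]
  exact weightedColorable_one_iff.symm.trans weightedChromaticNumber_le_iff.symm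

end Algorithm

end GraphColoring

theorem theorem3 (X : Set GraphColoring.FinGraph)
    (hX : GraphColoring.EasyForWeightedColoring X) :
    GraphColoring.EasyForWeightedColoring (GraphColoring.primeClosure X) ∧
      GraphColoring.EasyForColoring (GraphColoring.primeClosure X) := by
  have h := GraphColoring.poly_answer (X := X) hX.2
  refine ⟨⟨GraphColoring.hereditary_primeClosure X, ?_⟩,
    GraphColoring.hereditary_primeClosure X, ?_⟩
  · exact h.comp (GraphColoring.poly_of_table
      (f := fun I : GraphColoring.WeightedInstance (GraphColoring.primeClosure X) => I)
      GraphColoring.poly_parse)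
  · have := (h.comp GraphColoring.poly_weighted).encodeNat.leBits GraphColoring.poly_colors
    simp only [← GraphColoring.coloring_answer_eq] at this
    exact this
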